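/- Let $M$ be a smooth $3$-dimensional manifold with an almost contact metric structure $(\varphi,\zeta,\eta,g)$, i.e. a smooth $(1,1)$-tensor field $\varphi$, a smooth vector field $\zeta$, a smooth one-form $\eta$ and a Riemannian metric $g$ with $$\varphi^2+I=\eta\otimes\zeta,\qquad \eta(\zeta)=1,\qquad g(X,Y)=g(\varphi X,\varphi Y)+\eta(X)\eta(Y),$$ and let $\Phi(X,Y)=g(X,\varphi Y)$. Suppose that the structure is almost co-Kähler, that is, $d\eta=0$ and $d\Phi=0$. Suppose that it is $\eta$-Einstein with constant coefficients: $\mathrm{Ric}=a_1\,g+b_1\,\eta\otimes\eta$ with constants $a_1,b_1\in\mathbb{R}$, $b_1\neq 0$. Suppose further that $g$ is $(m,\rho)$-quasi-Einstein, where $0<m\le\infty$ and $\rho\in\mathbb{R}$: there are a smooth function $\omega:M\to\mathbb{R}$ and a constant $\lambda_1\in\mathbb{R}$ with $$\mathrm{Ric}+\mathrm{Hess}\,\omega-\tfrac1m\,d\omega\otimes d\omega=(\rho\,\tau+\lambda_1)\,g,$$ where $\tau$ is the scalar curvature and $\tfrac1m=0$ for $m=\infty$. If $m\neq 1$ and $m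 a_1\neq b_1$ (the latter being required only when $m<\infty$), then the structure is co-Kähler, that is, $\nabla\Phi=0$ for the Levi-Civita connection $\nabla$ of $g$. -/

import Mathlib

open scoped Manifold ContDiff ENNReal

noncomputable section

/-! ### Tensor calculus in a coordinate domain of `ℝᵈ` -/

/-- The `i`-th partial derivative `∂ᵢ f` at `x`. -/
def pderivCoord {d : ℕ} (i : Fin d) (f : EuclideanSpace ℝ (Fin d) → ℝ)
    (x : EuclideanSpace ℝ (Fin d)) : ℝ :=
  fderiv ℝ f x (EuclideanSpace.single i 1)

/-- The Christoffel symbol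
`Γᵏᵢⱼ = ½ ∑ₗ gᵏˡ (∂ᵢ gⱼₗ + ∂ⱼ gᵢₗ - ∂ₗ gᵢⱼ)` of a metric with component matrix `G`, that is,
`∇_{∂ᵢ} ∂ⱼ = ∑ₖ Γᵏᵢⱼ ∂ₖ` for the Levi-Civita connection `∇`. -/
def christoffelCoord {d : ℕ} (G : EuclideanSpace ℝ (Fin d) → Matrix (Fin d) (Fin d) ℝ)
    (k i j : Fin d) (x : EuclideanSpace ℝ (Fin d)) : ℝ :=
  (1 / 2 : ℝ) * ∑ l, (G x)⁻¹ k l *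
    (pderivCoord i (fun y => G y j l) x + pderivCoord j (fun y => G y i l) x
      - pderivCoord l (fun y => G y i j) x)

/-- The curvature component `Rˡᵢⱼₖ`, where `K(∂ᵢ, ∂ⱼ) ∂ₖ = ∑ₗ Rˡᵢⱼₖ ∂ₗ` and
`K(X, Y) = [∇_X, ∇_Y] - ∇_[X, Y]`. -/
def curvatureCoord {d : ℕ} (G : EuclideanSpace ℝ (Fin d) → Matrix (Fin d) (Fin d) ℝ)
    (l i j k : Fin d) (x : EuclideanSpace ℝ (Fin d)) : ℝ :=
  pderivCoord i (christoffelCoord G l j k) x - pderivCoord j (christoffelCoord G l i k) x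
    + ∑ p, (christoffelCoord G l i p x * christoffelCoord G p j k x
      - christoffelCoord G l j p x * christoffelCoord G p i k x)

/-- The Ricci component `Ric(∂ⱼ, ∂ₖ)`, the trace of `E ↦ K(E, ∂ⱼ) ∂ₖ`. -/
def ricciCoord {d : ℕ} (G : EuclideanSpace ℝ (Fin d) → Matrix (Fin d) (Fin d) ℝ)
    (j k : Fin d) (x : EuclideanSpace ℝ (Fin d)) : ℝ :=
  ∑ i, curvatureCoord G i i j k x

/-- The scalar curvature `τ = ∑ⱼₖ gʲᵏ Ric(∂ⱼ, ∂ₖ)`. -/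
def scalarCoord {d : ℕ} (G : EuclideanSpace ℝ (Fin d) → Matrix (Fin d) (Fin d) ℝ)
    (x : EuclideanSpace ℝ (Fin d)) : ℝ :=
  ∑ j, ∑ k, (G x)⁻¹ j k * ricciCoord G j k x

/-- The Hessian component `(Hess f)(∂ᵢ, ∂ⱼ) = ∂ᵢ ∂ⱼ f - ∑ₖ Γᵏᵢⱼ ∂ₖ f`. -/
def hessianCoord {d : ℕ} (G : EuclideanSpace ℝ (Fin d) → Matrix (Fin d) (Fin d) ℝ)
    (f : EuclideanSpace ℝ (Fin d) → ℝ) (i j : Fin d) (x : EuclideanSpace ℝ (Fin d)) : ℝ :=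
  pderivCoord i (pderivCoord j f) x - ∑ k, christoffelCoord G k i j x * pderivCoord k f x

/-- The component `(∇_{∂ₖ} B)(∂ᵢ, ∂ⱼ) = ∂ₖ Bᵢⱼ - ∑ₗ Γˡₖᵢ Bₗⱼ - ∑ₗ Γˡₖⱼ Bᵢₗ` of the covariant
derivative of a `(0, 2)`-tensor field with component matrix `B`. -/
def covDerivCoord {d : ℕ} (G B : EuclideanSpace ℝ (Fin d) → Matrix (Fin d) (Fin d) ℝ)
    (k i j : Fin d) (x : EuclideanSpace ℝ (Fin d)) : ℝ :=
  pderivCoord k (fun y => B y i j) x - ∑ l, christoffelCoord G l k i x * B x l j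
    - ∑ l, christoffelCoord G l k j x * B x i l

/-! ### Almost contact metric structures -/

/-- An almost contact metric structure `(φ, ζ, η, g)` on the smooth `d`-manifold `M`. -/
structure AlmostContactMetricStructure (d : ℕ) (M : Type*) [TopologicalSpace M]
    [ChartedSpace (EuclideanSpace ℝ (Fin d)) M] [IsManifold (𝓡 d) ∞ M] where
  /-- the smooth Riemannian metric -/
  g : Bundle.ContMDiffRiemannianMetric (𝓡 d) ∞ (EuclideanSpace ℝ (Fin d))
    (fun p : M => TangentSpace (𝓡 d) p)
  /-- the `(1, 1)`-tensor field -/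
  φ : (p : M) → TangentSpace (𝓡 d) p →L[ℝ] TangentSpace (𝓡 d) p
  /-- the characteristic vector field -/
  ζ : (p : M) → TangentSpace (𝓡 d) p
  /-- the one-form -/
  η : (p : M) → TangentSpace (𝓡 d) p →L[ℝ] ℝ
  contMDiff_φ : ContMDiff (𝓡 d)
    ((𝓡 d).prod 𝓘(ℝ, EuclideanSpace ℝ (Fin d) →L[ℝ] EuclideanSpace ℝ (Fin d))) ∞
    (fun p => Bundle.TotalSpace.mk' (EuclideanSpace ℝ (Fin d) →L[ℝ] EuclideanSpace ℝ (Fin d))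
      (E := fun p : M => TangentSpace (𝓡 d) p →L[ℝ] TangentSpace (𝓡 d) p) p (φ p))
  contMDiff_ζ : ContMDiff (𝓡 d) ((𝓡 d).prod 𝓘(ℝ, EuclideanSpace ℝ (Fin d))) ∞
    (fun p => Bundle.TotalSpace.mk' (EuclideanSpace ℝ (Fin d))
      (E := fun p : M => TangentSpace (𝓡 d) p) p (ζ p))
  contMDiff_η : ContMDiff (𝓡 d) ((𝓡 d).prod 𝓘(ℝ, EuclideanSpace ℝ (Fin d) →L[ℝ] ℝ)) ∞
    (fun p => Bundle.TotalSpace.mk' (EuclideanSpace ℝ (Fin d) →L[ℝ] ℝ)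
      (E := fun p : M => TangentSpace (𝓡 d) p →L[ℝ] ℝ) p (η p))
  φ_sq : ∀ (p : M) (v : TangentSpace (𝓡 d) p), φ p (φ p v) + v = η p v • ζ p
  η_ζ : ∀ p : M, η p (ζ p) = 1
  compatible : ∀ (p : M) (v w : TangentSpace (𝓡 d) p),
    g.inner p v w = g.inner p (φ p v) (φ p w) + η p v * η p w

/-- The coordinate vector `∂ᵢ` of the chart `e`, at the point of `M` with coordinates `x`. -/
def coordVector {d : ℕ} {M : Type*} [TopologicalSpace M]
    [ChartedSpace (EuclideanSpace ℝ (Fin d)) M]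
    (e : OpenPartialHomeomorph M (EuclideanSpace ℝ (Fin d))) (i : Fin d)
    (x : EuclideanSpace ℝ (Fin d)) : TangentSpace (𝓡 d) (e.symm x) :=
  mfderiv (𝓡 d) (𝓡 d) e.symm x
    (show TangentSpace (𝓡 d) x from EuclideanSpace.single i (1 : ℝ))

namespace AlmostContactMetricStructure

/-- The components `gᵢⱼ = g(∂ᵢ, ∂ⱼ)` of the metric in the chart `e`. -/
def gCoord {d : ℕ} {M : Type*} [TopologicalSpace M]
    [ChartedSpace (EuclideanSpace ℝ (Fin d)) M] [IsManifold (𝓡 d) ∞ M]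
    (S : AlmostContactMetricStructure d M)
    (e : OpenPartialHomeomorph M (EuclideanSpace ℝ (Fin d)))
    (x : EuclideanSpace ℝ (Fin d)) : Matrix (Fin d) (Fin d) ℝ :=
  Matrix.of fun i j => S.g.inner (e.symm x) (coordVector e i x) (coordVector e j x)

/-- The components `ηᵢ = η(∂ᵢ)` of the one-form in the chart `e`. -/
def ηCoord {d : ℕ} {M : Type*} [TopologicalSpace M]
    [ChartedSpace (EuclideanSpace ℝ (Fin d)) M] [IsManifold (𝓡 d) ∞ M]
    (S : AlmostContactMetricStructure d M)
    (e : OpenPartialHomeomorph M (EuclideanSpace ℝ (Fin d))) (i : Fin d)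
    (x : EuclideanSpace ℝ (Fin d)) : ℝ :=
  S.η (e.symm x) (coordVector e i x)

/-- The components `Φᵢⱼ = g(∂ᵢ, φ ∂ⱼ)`, in the chart `e`, of the fundamental `2`-form `Φ`. -/
def ΦCoord {d : ℕ} {M : Type*} [TopologicalSpace M]
    [ChartedSpace (EuclideanSpace ℝ (Fin d)) M] [IsManifold (𝓡 d) ∞ M]
    (S : AlmostContactMetricStructure d M)
    (e : OpenPartialHomeomorph M (EuclideanSpace ℝ (Fin d)))
    (x : EuclideanSpace ℝ (Fin d)) : Matrix (Fin d) (Fin d) ℝ :=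
  Matrix.of fun i j =>
    S.g.inner (e.symm x) (coordVector e i x) (S.φ (e.symm x) (coordVector e j x))

/-- The structure is almost co-Kähler: `dη = 0` and `dΦ = 0` (in every smooth chart,
`∂ᵢ ηⱼ = ∂ⱼ ηᵢ` and `∂ᵢ Φⱼₖ + ∂ⱼ Φₖᵢ + ∂ₖ Φᵢⱼ = 0`). -/
def IsAlmostCoKahler {d : ℕ} {M : Type*} [TopologicalSpace M]
    [ChartedSpace (EuclideanSpace ℝ (Fin d)) M] [IsManifold (𝓡 d) ∞ M]
    (S : AlmostContactMetricStructure d M) : Prop :=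
  ∀ e ∈ IsManifold.maximalAtlas (𝓡 d) ∞ M, ∀ x ∈ e.target,
    (∀ i j, pderivCoord i (S.ηCoord e j) x = pderivCoord j (S.ηCoord e i) x) ∧
    (∀ i j k, pderivCoord i (fun y => S.ΦCoord e y j k) x
      + pderivCoord j (fun y => S.ΦCoord e y k i) x
      + pderivCoord k (fun y => S.ΦCoord e y i j) x = 0)

/-- The structure is co-Kähler: it is almost co-Kähler and `∇Φ = 0`. -/
def IsCoKahler {d : ℕ} {M : Type*} [TopologicalSpace M]
    [ChartedSpace (EuclideanSpace ℝ (Fin d)) M] [IsManifold (𝓡 d) ∞ M]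
    (S : AlmostContactMetricStructure d M) : Prop :=
  S.IsAlmostCoKahler ∧
    ∀ e ∈ IsManifold.maximalAtlas (𝓡 d) ∞ M, ∀ x ∈ e.target,
      ∀ k i j, covDerivCoord (S.gCoord e) (S.ΦCoord e) k i j x = 0

/-- The `η`-Einstein condition `Ric = a₁ g + b₁ η ⊗ η` with constant coefficients. -/
def IsEtaEinstein {d : ℕ} {M : Type*} [TopologicalSpace M]
    [ChartedSpace (EuclideanSpace ℝ (Fin d)) M] [IsManifold (𝓡 d) ∞ M]
    (S : AlmostContactMetricStructure d M) (a₁ b₁ : ℝ) : Prop :=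
  ∀ e ∈ IsManifold.maximalAtlas (𝓡 d) ∞ M, ∀ x ∈ e.target, ∀ i j,
    ricciCoord (S.gCoord e) i j x
      = a₁ * S.gCoord e x i j + b₁ * (S.ηCoord e i x * S.ηCoord e j x)

/-- The metric is `(m, ρ)`-quasi-Einstein: for some smooth function `w` and some real constant
`λ₁`, `Ric + Hess w - (1/m) dw ⊗ dw = (ρ τ + λ₁) g`. Here `m` may be `∞`, and then `1/m = 0`. -/
def IsQuasiEinstein {d : ℕ} {M : Type*} [TopologicalSpace M]
    [ChartedSpace (EuclideanSpace ℝ (Fin d)) M] [IsManifold (𝓡 d) ∞ M]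
    (S : AlmostContactMetricStructure d M) (m : ℝ≥0∞) (ρ : ℝ) : Prop :=
  ∃ (w : M → ℝ) (lam : ℝ), ContMDiff (𝓡 d) 𝓘(ℝ, ℝ) ∞ w ∧
    ∀ e ∈ IsManifold.maximalAtlas (𝓡 d) ∞ M, ∀ x ∈ e.target, ∀ i j,
      ricciCoord (S.gCoord e) i j x + hessianCoord (S.gCoord e) (w ∘ e.symm) i j x
        - (m⁻¹).toReal * (pderivCoord i (w ∘ e.symm) x * pderivCoord j (w ∘ e.symm) x)
      = (ρ * scalarCoord (S.gCoord e) x + lam) * S.gCoord e x i j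

end AlmostContactMetricStructure

end

/-! The claim is local and reduces to `∇η = 0`. By the `η`-Einstein condition the scalar curvature
is the constant `3a₁ + b₁`, so in a chart the quasi-Einstein equation becomes `Hess f = s df ⊗ df +
ν g - b η ⊗ η` with `s`, `ν`, `b` constant and `b = b₁ ≠ 0`.

Differentiating this and antisymmetrizing (`ricci_identity_of_covDeriv_eq`) expresses `df (K(t, u)
v)` through `df`, `g`, `η` and `∇η`. In an orthonormal frame `E₁, E₂, E₃ = ζ`, the Ricci tensor is
diagonal with equal entries on `E₁, E₂`. In dimension three this kills the mixed curvature
components that occur and equates the sectional curvatures of the planes `E₁E₃` and `E₂E₃`.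
Evaluating the identity at `K(Eᵢ, E₃) Eⱼ` with `i, j ∈ {1, 2}`, the curvature and the `s`-term
contribute equally to both diagonal entries and nothing off the diagonal. Since `b ≠ 0`, `∇η` is a
multiple of `g` on `ker η` (`covDerivOne_umbilic`).

On the other side, `Φ ⊗ Φ` is a polynomial in `g` and `η` (`IsAdaptedFrame.area`). Differentiating
that polynomial expresses `∇Φ` through `∇η`. Then `dΦ = 0` makes `∇η` trace-free on `ker η`, and
also `∇η(·, ζ) = 0` (`covDerivOne_trace`). With the symmetry given by `dη = 0` this leaves `∇η = 0`,
hence `∇Φ = 0`. -/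

noncomputable section

/-! ### Frame-free calculus of a connection on a vector space; curvature and the Ricci identity. -/

section Calculus

set_option maxSynthPendingDepth 3

open Filter Topology

variable {V W : Type*} [NormedAddCommGroup V] [NormedSpace ℝ V] [NormedAddCommGroup W]
  [NormedSpace ℝ W]

/-- Leibniz rule for a linear-map valued function applied to a moving vector. -/
lemma fderiv_clm_apply_one {B : V → V →L[ℝ] W} {X : V → V} {x : V}
    (hB : DifferentiableAt ℝ B x) (hX : DifferentiableAt ℝ X x) (t : V) :
    fderiv ℝ (fun y => B y (X y)) x t = fderiv ℝ B x t (X x) + B x (fderiv ℝ X x t) := by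
  rw [(hB.hasFDerivAt.clm_apply hX.hasFDerivAt).fderiv]
  simp [add_comm]

/-- Leibniz rule for a bilinear-map valued function applied to two moving vectors. -/
lemma fderiv_clm_apply_two {B : V → V →L[ℝ] V →L[ℝ] W} {X Y : V → V} {x : V}
    (hB : DifferentiableAt ℝ B x) (hX : DifferentiableAt ℝ X x) (hY : DifferentiableAt ℝ Y x)
    (t : V) :
    fderiv ℝ (fun y => B y (X y) (Y y)) x t
      = fderiv ℝ B x t (X x) (Y x) + B x (fderiv ℝ X x t) (Y x) + B x (X x) (fderiv ℝ Y x t) := by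
  rw [fderiv_clm_apply_one (hB.clm_apply hX) hY, fderiv_clm_apply_one hB hX]
  simp

lemma fderiv_clm_apply_const {B : V → V →L[ℝ] W} {x : V} (hB : DifferentiableAt ℝ B x) (u t : V) :
    fderiv ℝ (fun y => B y u) x t = fderiv ℝ B x t u := by
  simpa using fderiv_clm_apply_one hB (differentiableAt_const u) t

lemma fderiv_clm_apply_const_two {B : V → V →L[ℝ] V →L[ℝ] W} {x : V}
    (hB : DifferentiableAt ℝ B x) (u v t : V) :
    fderiv ℝ (fun y => B y u v) x t = fderiv ℝ B x t u v := by
  simpa using fderiv_clm_apply_two hB (differentiableAt_const u) (differentiableAt_const v) t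

/-- The curvature operator `K(u, v) w` of a connection with Christoffel map `Γ`. -/
def curvatureOp (Γ : V → V →L[ℝ] V →L[ℝ] V) (x u v w : V) : V :=
  fderiv ℝ Γ x u v w - fderiv ℝ Γ x v u w + (Γ x u (Γ x v w) - Γ x v (Γ x u w))

/-- The covariant derivative `(∇ᵤ α) v` of a one-form. -/
def covDerivOne (Γ : V → V →L[ℝ] V →L[ℝ] V) (α : V → V →L[ℝ] ℝ) (x u v : V) : ℝ :=
  fderiv ℝ α x u v - α x (Γ x u v)

/-- The covariant derivative `(∇ₜ B) (u, v)` of a `(0, 2)`-tensor. -/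
def covDerivTwo (Γ : V → V →L[ℝ] V →L[ℝ] V) (B : V → V →L[ℝ] V →L[ℝ] ℝ) (x t u v : V) : ℝ :=
  fderiv ℝ B x t u v - B x (Γ x t u) v - B x u (Γ x t v)

variable {g Φ : V → V →L[ℝ] V →L[ℝ] ℝ} {Γ : V → V →L[ℝ] V →L[ℝ] V} {η θ : V → V →L[ℝ] ℝ} {x : V}

lemma curvatureOp_swap (u v w : V) : curvatureOp Γ x u v w = - curvatureOp Γ x v u w := by
  simp only [curvatureOp]; abel

/-- The curvature of a metric connection is skew-symmetric. -/
lemma curvatureOp_skew (hg : ContDiffAt ℝ 2 g x) (hΓ : DifferentiableAt ℝ Γ x)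
    (hcompat : ∀ᶠ y in 𝓝 x, ∀ u v w,
      fderiv ℝ g y u v w = g y (Γ y u v) w + g y v (Γ y u w)) (u v w z : V) :
    g x (curvatureOp Γ x u v w) z + g x w (curvatureOp Γ x u v z) = 0 := by
  have hg1 : DifferentiableAt ℝ g x := hg.differentiableAt (by norm_num)
  have hg2 : DifferentiableAt ℝ (fderiv ℝ g) x :=
    (hg.fderiv_right (m := 1) (by norm_num)).differentiableAt (by norm_num)
  have hΓc : ∀ u v, DifferentiableAt ℝ (fun y => Γ y u v) x := fun u v =>
    (hΓ.clm_apply (differentiableAt_const u)).clm_apply (differentiableAt_const v)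
  -- The derivative of `∇g = 0`; exchanging `t` and `u` leaves the left side fixed, and the
  -- difference of the two right sides is the skewness.
  have key : ∀ t u v w, fderiv ℝ (fderiv ℝ g) x t u v w
      = fderiv ℝ g x t (Γ x u v) w + g x (fderiv ℝ Γ x t u v) w
        + (fderiv ℝ g x t v (Γ x u w) + g x v (fderiv ℝ Γ x t u w)) := by
    intro t u v w
    have e1 := (show (fun y => fderiv ℝ g y u v w) =ᶠ[𝓝 x]
      fun y => g y (Γ y u v) w + g y v (Γ y u w) from
        hcompat.mono fun y hy => hy u v w).fderiv_eq (𝕜 := ℝ)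
    have e2 := DFunLike.congr_fun e1 t
    rw [fderiv_clm_apply_const_two (hg2.clm_apply (differentiableAt_const u)),
      fderiv_clm_apply_const hg2, fderiv_fun_add, add_apply,
      fderiv_clm_apply_two hg1 (hΓc u v) (differentiableAt_const w),
      fderiv_clm_apply_two hg1 (differentiableAt_const v) (hΓc u w),
      fderiv_clm_apply_const_two hΓ, fderiv_clm_apply_const_two hΓ] at e2
    · simpa using e2
    · exact (hg1.clm_apply (hΓc u v)).clm_apply (differentiableAt_const w)
    · exact (hg1.clm_apply (differentiableAt_const v)).clm_apply (hΓc u w)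
  have hsymm := (hg.isSymmSndFDerivAt (by simp)) u v
  have h1 := key u v w z
  have h2 := key v u w z
  rw [hsymm] at h1
  have hc := hcompat.self_of_nhds
  simp only [hc] at h1 h2
  simp only [curvatureOp, map_add, map_sub, add_apply,
    sub_apply]
  linear_combination h2 - h1

/-- The Ricci identity for a closed one-form `θ` whose covariant derivative is
`s θ ⊗ θ + ν g - b η ⊗ η`, where `η` is closed. -/
lemma ricci_identity_of_covDeriv_eq {s ν b : ℝ} (hg : DifferentiableAt ℝ g x)
    (hΓ : DifferentiableAt ℝ Γ x) (hη : DifferentiableAt ℝ η x)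
    (hθ : ContDiffAt ℝ 1 θ x) (hΓs : ∀ u v, Γ x u v = Γ x v u)
    (hgs : ∀ u v, g x u v = g x v u)
    (hcompat : ∀ u v w, fderiv ℝ g x u v w = g x (Γ x u v) w + g x v (Γ x u w))
    (hηc : ∀ u v, fderiv ℝ η x u v = fderiv ℝ η x v u)
    (hθs : ∀ t u v, fderiv ℝ (fderiv ℝ θ) x t u v = fderiv ℝ (fderiv ℝ θ) x u t v)
    (hθ2 : DifferentiableAt ℝ (fderiv ℝ θ) x)
    (hess : ∀ᶠ y in 𝓝 x, ∀ u v, covDerivOne Γ θ y u v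
      = s * (θ y u * θ y v) + ν * g y u v - b * (η y u * η y v))
    (t u v : V) :
    θ x (curvatureOp Γ x t u v)
      = - s * (θ x u * (ν * g x t v - b * (η x t * η x v))
          - θ x t * (ν * g x u v - b * (η x u * η x v)))
        + b * (η x u * covDerivOne Γ η x t v - η x t * covDerivOne Γ η x u v) := by
  have hθ1 : DifferentiableAt ℝ θ x := hθ.differentiableAt (by norm_num)
  have hΓc : ∀ u v, DifferentiableAt ℝ (fun y => Γ y u v) x := fun u v =>
    (hΓ.clm_apply (differentiableAt_const u)).clm_apply (differentiableAt_const v)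
  have hθc : ∀ u, DifferentiableAt ℝ (fun y => θ y u) x := fun u =>
    hθ1.clm_apply (differentiableAt_const u)
  have hηd : ∀ u, DifferentiableAt ℝ (fun y => η y u) x := fun u =>
    hη.clm_apply (differentiableAt_const u)
  have hgd : ∀ u v, DifferentiableAt ℝ (fun y => g y u v) x := fun u v =>
    (hg.clm_apply (differentiableAt_const u)).clm_apply (differentiableAt_const v)
  -- The derivative of the Hessian equation, with `s`, `ν`, `b` constant. Antisymmetrized in `t, u`,
  -- the second derivatives of `θ` cancel and `fderiv ℝ Γ` enters only through the curvature.
  have key : ∀ t u v, fderiv ℝ (fderiv ℝ θ) x t u v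
      = fderiv ℝ θ x t (Γ x u v) + θ x (fderiv ℝ Γ x t u v)
        + s * (fderiv ℝ θ x t u * θ x v + θ x u * fderiv ℝ θ x t v)
        + ν * fderiv ℝ g x t u v
        - b * (fderiv ℝ η x t u * η x v + η x u * fderiv ℝ η x t v) := by
    intro t u v
    have e1 : (fun y => fderiv ℝ θ y u v) =ᶠ[𝓝 x] fun y => θ y (Γ y u v) +
        (s * (θ y u * θ y v) + ν * g y u v - b * (η y u * η y v)) := by
      refine hess.mono fun y hy => ?_
      have := hy u v
      simp only [covDerivOne] at this
      linear_combination this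
    have hr := (((hθ1.hasFDerivAt.clm_apply (hΓc u v).hasFDerivAt)).add
      (((((hθc u).hasFDerivAt.mul (hθc v).hasFDerivAt).const_mul s).add
        ((hgd u v).hasFDerivAt.const_mul ν)).sub
        (((hηd u).hasFDerivAt.mul (hηd v).hasFDerivAt).const_mul b))).fderiv
    have e2 := DFunLike.congr_fun (e1.fderiv_eq.trans hr) t
    rw [fderiv_clm_apply_const_two hθ2] at e2
    rw [e2]
    simp [fderiv_clm_apply_const hθ1, fderiv_clm_apply_const hη, fderiv_clm_apply_const_two hg,
      fderiv_clm_apply_const_two hΓ]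
    ring
  have h1 := key t u v
  have h2 := key u t v
  rw [hθs] at h1
  have hx : ∀ u v, fderiv ℝ θ x u v = θ x (Γ x u v) +
        (s * (θ x u * θ x v) + ν * g x u v - b * (η x u * η x v)) := by
    intro u v
    have := hess.self_of_nhds u v
    simp only [covDerivOne] at this
    linear_combination this
  simp only [hx, hcompat] at h1 h2
  simp only [curvatureOp, covDerivOne, map_add, map_sub]
  have e3 := hηc t u
  rw [hΓs u t, hgs u t] at h2
  linear_combination h2 - h1 + b * η x v * e3

end Calculus
-- Pointwise algebra in an adapted frame: trace and umbilicity of `∇η`.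
section AdaptedFrame

open Filter Topology

set_option maxSynthPendingDepth 3

variable {V : Type*} [NormedAddCommGroup V] [NormedSpace ℝ V]

/-- An orthonormal frame `E₁, E₂, E₃` with `η = g(E₃, ·)`, adapted to the two-form `Φ`. -/
structure IsAdaptedFrame (g Φ : V →L[ℝ] V →L[ℝ] ℝ) (η : V →L[ℝ] ℝ) (E₁ E₂ E₃ : V) : Prop where
  expand : ∀ v, v = g v E₁ • E₁ + g v E₂ • E₂ + η v • E₃
  g₁₁ : g E₁ E₁ = 1
  g₁₂ : g E₁ E₂ = 0
  g₂₁ : g E₂ E₁ = 0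
  g₂₂ : g E₂ E₂ = 1
  g₃ : ∀ v, g v E₃ = η v
  g₃' : ∀ v, g E₃ v = η v
  η₁ : η E₁ = 0
  η₂ : η E₂ = 0
  η₃ : η E₃ = 1
  Φ₁₂ : Φ E₁ E₂ = -1
  Φ₁₃ : Φ E₁ E₃ = 0
  Φ₂₃ : Φ E₂ E₃ = 0
  Φ_swap : ∀ u v, Φ u v = - Φ v u

/-- The two-form of an adapted frame squares to the area form of `g - η ⊗ η`. -/
lemma IsAdaptedFrame.area {g Φ : V →L[ℝ] V →L[ℝ] ℝ} {η : V →L[ℝ] ℝ} {E₁ E₂ E₃ : V}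
    (h : IsAdaptedFrame g Φ η E₁ E₂ E₃) (u v w z : V) :
    Φ u v * Φ w z = (g u w - η u * η w) * (g v z - η v * η z)
      - (g u z - η u * η z) * (g v w - η v * η w) := by
  -- `Φ` is minus the determinant of the `E₁, E₂` components, and a product of two such determinants
  -- is a Gram determinant.
  have hd : ∀ u v, Φ u v = - (g u E₁ * g v E₂ - g u E₂ * g v E₁) := by
    intro u v
    have h11 : Φ E₁ E₁ = 0 := by linarith [h.Φ_swap E₁ E₁]
    have h22 : Φ E₂ E₂ = 0 := by linarith [h.Φ_swap E₂ E₂]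
    have h33 : Φ E₃ E₃ = 0 := by linarith [h.Φ_swap E₃ E₃]
    have h21 : Φ E₂ E₁ = 1 := by rw [h.Φ_swap, h.Φ₁₂]; simp
    have h31 : Φ E₃ E₁ = 0 := by rw [h.Φ_swap, h.Φ₁₃]; simp
    have h32 : Φ E₃ E₂ = 0 := by rw [h.Φ_swap, h.Φ₂₃]; simp
    conv_lhs => rw [h.expand u, h.expand v]
    simp only [map_add, map_smul, add_apply, smul_apply, smul_eq_mul, h11, h22, h33, h21, h31,
      h32, h.Φ₁₂, h.Φ₁₃, h.Φ₂₃]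
    ring
  have hh : ∀ u v, g u v - η u * η v = g u E₁ * g v E₁ + g u E₂ * g v E₂ := by
    intro u v
    have : g u v = g u (g v E₁ • E₁ + g v E₂ • E₂ + η v • E₃) := by rw [← h.expand v]
    rw [this]
    simp only [map_add, map_smul, smul_eq_mul, h.g₃]
    ring
  simp only [hd, hh]
  ring

variable {g Φ : V → V →L[ℝ] V →L[ℝ] ℝ} {Γ : V → V →L[ℝ] V →L[ℝ] V} {η θ : V → V →L[ℝ] ℝ}
  {x E₁ E₂ E₃ : V}

/-- The covariant derivative of the identity `IsAdaptedFrame.area`. -/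
lemma covDerivTwo_area (hg : DifferentiableAt ℝ g x) (hΦ : DifferentiableAt ℝ Φ x)
    (hη : DifferentiableAt ℝ η x)
    (hcompat : ∀ u v w, fderiv ℝ g x u v w = g x (Γ x u v) w + g x v (Γ x u w))
    (harea : ∀ᶠ y in 𝓝 x, ∀ u v w z, Φ y u v * Φ y w z
      = (g y u w - η y u * η y w) * (g y v z - η y v * η y z)
        - (g y u z - η y u * η y z) * (g y v w - η y v * η y w)) (t u v w z : V) :
    covDerivTwo Γ Φ x t u v * Φ x w z + Φ x u v * covDerivTwo Γ Φ x t w z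
      = - (covDerivOne Γ η x t u * η x w + η x u * covDerivOne Γ η x t w)
            * (g x v z - η x v * η x z)
        - (g x u w - η x u * η x w)
            * (covDerivOne Γ η x t v * η x z + η x v * covDerivOne Γ η x t z)
        + (covDerivOne Γ η x t u * η x z + η x u * covDerivOne Γ η x t z)
            * (g x v w - η x v * η x w)
        + (g x u z - η x u * η x z)
            * (covDerivOne Γ η x t v * η x w + η x v * covDerivOne Γ η x t w) := by
  have e1 : (fun y => Φ y u v * Φ y w z) =ᶠ[𝓝 x] fun y =>
      (g y u w - η y u * η y w) * (g y v z - η y v * η y z)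
        - (g y u z - η y u * η y z) * (g y v w - η y v * η y w) := harea.mono fun y hy => hy u v w z
  have hηd : ∀ u, HasFDerivAt (fun y => η y u) _ x := fun u =>
    (hη.clm_apply (differentiableAt_const u)).hasFDerivAt
  have hgd : ∀ u v, HasFDerivAt (fun y => g y u v) _ x := fun u v =>
    ((hg.clm_apply (differentiableAt_const u)).clm_apply (differentiableAt_const v)).hasFDerivAt
  have hΦd : ∀ u v, HasFDerivAt (fun y => Φ y u v) _ x := fun u v =>
    ((hΦ.clm_apply (differentiableAt_const u)).clm_apply (differentiableAt_const v)).hasFDerivAt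
  have hl := ((hΦd u v).mul (hΦd w z)).fderiv
  have hr := ((((hgd u w).sub ((hηd u).mul (hηd w))).mul ((hgd v z).sub ((hηd v).mul (hηd z)))).sub
    (((hgd u z).sub ((hηd u).mul (hηd z))).mul ((hgd v w).sub ((hηd v).mul (hηd w))))).fderiv
  have e2 := DFunLike.congr_fun (hl.symm.trans ((e1.fderiv_eq (𝕜 := ℝ)).trans hr)) t
  simp only [add_apply, sub_apply, smul_apply, smul_eq_mul, Pi.sub_apply, Pi.mul_apply,
    fderiv_clm_apply_const hη, fderiv_clm_apply_const_two hg, fderiv_clm_apply_const_two hΦ, hcompat] at e2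
  have ha := harea.self_of_nhds
  simp only [covDerivTwo, covDerivOne]
  -- The connection terms are the undifferentiated identity with one argument at a time replaced by
  -- its image under `Γ x t`.
  linear_combination e2 - ha (Γ x t u) v w z - ha u (Γ x t v) w z - ha u v (Γ x t w) z
    - ha u v w (Γ x t z)

/-- In an adapted frame, `Φ` closed and `η` closed make `∇η` trace-free. -/
lemma covDerivOne_trace (hE : IsAdaptedFrame (g x) (Φ x) (η x) E₁ E₂ E₃)
    (hNs : ∀ t u v, covDerivTwo Γ Φ x t u v = - covDerivTwo Γ Φ x t v u)
    (hdΦ : ∀ t u v, covDerivTwo Γ Φ x t u v + covDerivTwo Γ Φ x u v t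
      + covDerivTwo Γ Φ x v t u = 0)
    (hN : ∀ t u v w z, covDerivTwo Γ Φ x t u v * Φ x w z + Φ x u v * covDerivTwo Γ Φ x t w z
      = - (covDerivOne Γ η x t u * η x w + η x u * covDerivOne Γ η x t w)
            * (g x v z - η x v * η x z)
        - (g x u w - η x u * η x w)
            * (covDerivOne Γ η x t v * η x z + η x v * covDerivOne Γ η x t z)
        + (covDerivOne Γ η x t u * η x z + η x u * covDerivOne Γ η x t z)
            * (g x v w - η x v * η x w)
        + (g x u z - η x u * η x z)
            * (covDerivOne Γ η x t v * η x w + η x v * covDerivOne Γ η x t w)) :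
    covDerivOne Γ η x E₁ E₁ + covDerivOne Γ η x E₂ E₂ = 0 ∧
      ((∀ t, covDerivOne Γ η x t E₁ = 0) → (∀ t, covDerivOne Γ η x t E₂ = 0) →
        ∀ t u v, covDerivTwo Γ Φ x t u v = 0) ∧ ∀ t, covDerivOne Γ η x t E₃ = 0 := by
  -- Pairing with `(E₁, E₂)`, where `Φ = -1`, lets the differentiated area identity be solved for
  -- each component of `∇Φ`.
  have h12 : ∀ t, covDerivTwo Γ Φ x t E₁ E₂ = 0 := by
    intro t
    have := hN t E₁ E₂ E₁ E₂
    simp only [hE.Φ₁₂, hE.g₁₁, hE.g₁₂, hE.g₂₁, hE.g₂₂, hE.η₁, hE.η₂] at this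
    linarith
  have h13 : ∀ t, covDerivTwo Γ Φ x t E₁ E₃ = covDerivOne Γ η x t E₂ := by
    intro t
    have := hN t E₁ E₃ E₁ E₂
    simp only [hE.Φ₁₂, hE.Φ₁₃, hE.g₁₁, hE.g₁₂, hE.g₃', hE.η₁, hE.η₂, hE.η₃] at this
    linarith
  have h23 : ∀ t, covDerivTwo Γ Φ x t E₂ E₃ = - covDerivOne Γ η x t E₁ := by
    intro t
    have := hN t E₂ E₃ E₁ E₂
    simp only [hE.Φ₁₂, hE.Φ₂₃, hE.g₂₁, hE.g₂₂, hE.g₃', hE.η₁, hE.η₂, hE.η₃] at this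
    linarith
  refine ⟨?_, fun h1 h2 t u v => ?_, fun t => ?_⟩
  · have := hdΦ E₁ E₂ E₃
    rw [hNs E₂, h23, h13, h12] at this
    linarith
  · have key : ∀ u v, covDerivTwo Γ Φ x t u v = 0 := by
      have hd : ∀ a, covDerivTwo Γ Φ x t a a = 0 := fun a => by linarith [hNs t a a]
      have hadd : ∀ a b c, covDerivTwo Γ Φ x t (a + b) c
          = covDerivTwo Γ Φ x t a c + covDerivTwo Γ Φ x t b c := by
        intro a b c; simp only [covDerivTwo, map_add, add_apply]; ring
      have hsm : ∀ (r : ℝ) a c, covDerivTwo Γ Φ x t (r • a) c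
          = r * covDerivTwo Γ Φ x t a c := by
        intro r a c; simp only [covDerivTwo, map_smul, smul_apply, smul_eq_mul]; ring
      have hz1 : ∀ v, covDerivTwo Γ Φ x t E₁ v = 0 := by
        intro v
        rw [hNs, hE.expand v, hadd, hadd, hsm, hsm, hsm, hd, hNs t E₂, hNs t E₃, h12, h13, h2]
        ring
      have hz2 : ∀ v, covDerivTwo Γ Φ x t E₂ v = 0 := by
        intro v
        rw [hNs, hE.expand v, hadd, hadd, hsm, hsm, hsm, hd, hNs t E₃, h12, h23, h1]
        ring
      have hz3 : ∀ v, covDerivTwo Γ Φ x t E₃ v = 0 := by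
        intro v
        rw [hNs, hE.expand v, hadd, hadd, hsm, hsm, hsm, hd, hz1, hz2]
        ring
      intro u v
      rw [hE.expand u, hadd, hadd, hsm, hsm, hsm, hz1, hz2, hz3]
      ring
    exact key u v
  -- Here `Φ(E₁, E₃) = 0` annihilates the left side, while the right side is `-2 (∇ₜ η) E₃`.
  · have := hN t E₁ E₃ E₁ E₃
    simp only [hE.Φ₁₃, hE.g₁₁, hE.g₃, hE.g₃', hE.η₁, hE.η₃] at this
    linarith

/-- On an `η`-Einstein three-manifold, a Hessian of the form `s θ ⊗ θ + ν g - b η ⊗ η` with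
`b ≠ 0` forces the restriction of `∇η` to `ker η` to be a multiple of the metric. -/
lemma covDerivOne_umbilic {a b s ν : ℝ} (hb : b ≠ 0)
    (hE : IsAdaptedFrame (g x) (Φ x) (η x) E₁ E₂ E₃)
    (hskew : ∀ u v w z, g x (curvatureOp Γ x u v w) z + g x w (curvatureOp Γ x u v z) = 0)
    (hgs : ∀ u v, g x u v = g x v u)
    (hRic : ∀ v w, g x (curvatureOp Γ x E₁ v w) E₁ + g x (curvatureOp Γ x E₂ v w) E₂
      + g x (curvatureOp Γ x E₃ v w) E₃ = a * g x v w + b * (η x v * η x w))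
    (hθ : ∀ t u v, θ x (curvatureOp Γ x t u v)
      = - s * (θ x u * (ν * g x t v - b * (η x t * η x v))
          - θ x t * (ν * g x u v - b * (η x u * η x v)))
        + b * (η x u * covDerivOne Γ η x t v - η x t * covDerivOne Γ η x u v)) :
    covDerivOne Γ η x E₁ E₁ = covDerivOne Γ η x E₂ E₂ ∧ covDerivOne Γ η x E₁ E₂ = 0 ∧
      covDerivOne Γ η x E₂ E₁ = 0 := by
  set r : V → V → V → V → ℝ := fun u v w z => g x (curvatureOp Γ x u v w) z with hr
  have s1 : ∀ u v w z, r u v w z = - r v u w z := by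
    intro u v w z; simp only [hr]; rw [curvatureOp_swap]; simp
  have s2 : ∀ u v w z, r u v w z = - r u v z w := by
    intro u v w z
    have := hskew u v w z
    rw [hgs w] at this
    simp only [hr]; linarith
  have s0 : ∀ u w z, r u u w z = 0 := fun u w z => by linarith [s1 u u w z]
  have s0' : ∀ u v w, r u v w w = 0 := fun u v w => by linarith [s2 u v w w]
  have hRic' : ∀ v w, r E₁ v w E₁ + r E₂ v w E₂ + r E₃ v w E₃
    = a * g x v w + b * (η x v * η x w) := hRic
  have hθr : ∀ u v w, θ x (curvatureOp Γ x u v w)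
      = r u v w E₁ * θ x E₁ + r u v w E₂ * θ x E₂ + r u v w E₃ * θ x E₃ := by
    intro u v w
    conv_lhs => rw [hE.expand (curvatureOp Γ x u v w)]
    simp only [map_add, map_smul, smul_eq_mul, hr, hE.g₃]
  have R11 := hRic' E₁ E₁
  have R12 := hRic' E₁ E₂
  have R21 := hRic' E₂ E₁
  have R22 := hRic' E₂ E₂
  have R31 := hRic' E₃ E₁
  have R32 := hRic' E₃ E₂
  have t11 := hθ E₁ E₃ E₁
  have t12 := hθ E₁ E₃ E₂
  have t21 := hθ E₂ E₃ E₁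
  have t22 := hθ E₂ E₃ E₂
  simp only [hE.g₁₁, hE.g₁₂, hE.g₂₁, hE.g₂₂, hE.g₃', hE.η₁, hE.η₂, hE.η₃, s0, s0', hθr]
    at R11 R12 R21 R22 R31 R32 t11 t12 t21 t22
  rw [s1 E₃ E₁, s2 E₁ E₃] at R11
  rw [s1 E₂ E₁, s2 E₁ E₂] at R11
  rw [s1 E₃ E₂, s2 E₂ E₃] at R22
  rw [s1 E₃] at R12 R21
  rw [s2 E₁ E₃ E₁ E₂] at t11
  rw [s2 E₂ E₃ E₂ E₁] at t22
  -- `z1` to `z4` come from the vanishing off-diagonal Ricci entries, each of which has a single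
  -- surviving curvature term. For `z5`, `Ric(E₁, E₁) = Ric(E₂, E₂)` and both contain the sectional
  -- curvature of the plane `E₁E₂`.
  have z1 : r E₁ E₃ E₂ E₁ = 0 := by linarith
  have z2 : r E₂ E₃ E₁ E₂ = 0 := by linarith
  have z3 : r E₁ E₃ E₂ E₃ = 0 := by linarith
  have z4 : r E₂ E₃ E₁ E₃ = 0 := by linarith
  have z5 : r E₁ E₃ E₁ E₃ = r E₂ E₃ E₂ E₃ := by
    linarith [s2 E₁ E₃ E₁ E₃, s2 E₂ E₃ E₂ E₃]
  rw [z1, z5] at t11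
  rw [z2] at t22
  rw [z1, z3] at t12
  rw [z2, z4] at t21
  -- By `t11` and `t22`, both diagonal entries times `b` equal `(r E₂ E₃ E₂ E₃ + s ν) θ(E₃)`.
  refine ⟨mul_left_cancel₀ hb ?_, mul_left_cancel₀ hb ?_, mul_left_cancel₀ hb ?_⟩ <;> linarith

end AdaptedFrame
-- Linear algebra of an almost contact metric structure: existence of an adapted frame.
section ExistsFrame

variable {V : Type*} [NormedAddCommGroup V] [NormedSpace ℝ V]

/-- Three orthonormal vectors of a three-dimensional space with inner product span it. -/
lemma eq_sum_of_orthonormal [FiniteDimensional ℝ V] (hd : Module.finrank ℝ V = 3)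
    (g : V →L[ℝ] V →L[ℝ] ℝ) {E : Fin 3 → V} (hE : ∀ i j, g (E i) (E j) = if i = j then 1 else 0) (v : V) :
    v = ∑ i, g v (E i) • E i := by
  have hsum : ∀ (c : Fin 3 → ℝ) j, g (∑ i, c i • E i) (E j) = c j := by
    intro c j
    simp [map_sum, hE]
  have hli : LinearIndependent ℝ E := by
    rw [Fintype.linearIndependent_iff]
    intro c hc j
    rw [← hsum c j, hc]; simp
  have htop := hli.span_eq_top_of_card_eq_finrank' (by simp [hd])
  have hv : v ∈ Submodule.span ℝ (Set.range E) := htop ▸ Submodule.mem_top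
  obtain ⟨c, rfl⟩ := (Submodule.mem_span_range_iff_exists_fun ℝ).1 hv
  simp only [hsum]

/-- An almost contact metric structure on a three-dimensional vector space has an adapted
frame whose last vector is the characteristic vector. -/
lemma exists_isAdaptedFrame (hd : Module.finrank ℝ V = 3) {g Φ : V →L[ℝ] V →L[ℝ] ℝ}
    (hs : ∀ u v, g u v = g v u) (hpos : ∀ v, v ≠ 0 → 0 < g v v) {φ : V →L[ℝ] V} {ζ : V}
    {η : V →L[ℝ] ℝ} (hφ : ∀ v, φ (φ v) + v = η v • ζ) (hη : η ζ = 1)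
    (hc : ∀ v w, g v w = g (φ v) (φ w) + η v * η w) (hΦ : ∀ v w, Φ v w = g v (φ w)) :
    ∃ E₁ E₂, IsAdaptedFrame g Φ η E₁ E₂ ζ := by
  have hζ0 : ζ ≠ 0 := by rintro rfl; simp at hη
  -- `φ` commutes with `φ² + I = η ⊗ ζ`. At `v = ζ` this gives `φ ζ = c ζ` with `c = η (φ ζ)`; then
  -- `φ² ζ = 0` forces `c² = 0`, so `φ ζ = 0` and `η ∘ φ = 0`.
  have hcomm : ∀ v, η (φ v) • ζ = η v • φ ζ := by
    intro v
    rw [← hφ (φ v), ← map_smul, ← hφ v, map_add]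
  have h1 : φ ζ = η (φ ζ) • ζ := by simpa [hη] using (hcomm ζ).symm
  have hηφζ : η (φ ζ) = 0 := by
    have h2 := hφ ζ
    rw [h1, map_smul, hη, one_smul] at h2
    have h3 : η (φ ζ) • φ ζ = 0 := by simpa using h2
    have h4 := congrArg η h3
    simpa using h4
  have hφζ : φ ζ = 0 := by rw [h1, hηφζ, zero_smul]
  have hηφ : ∀ v, η (φ v) = 0 := by
    intro v
    have := hcomm v
    rw [hφζ, smul_zero, smul_eq_zero] at this
    exact this.resolve_right hζ0
  have hgζ : ∀ v, g v ζ = η v := fun v => by rw [hc, hφζ, hη]; simp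
  have hskew : ∀ u v, Φ u v = - Φ v u := by
    intro u v
    have h2 : φ (φ v) = η v • ζ - v := eq_sub_of_add_eq (hφ v)
    rw [hΦ, hΦ, hc u, h2, hηφ, map_sub, map_smul, hgζ, hηφ, hs v]
    simp
  have : FiniteDimensional ℝ V := Module.finite_of_finrank_eq_succ hd
  have hker : LinearMap.ker (η : V →ₗ[ℝ] ℝ) ≠ ⊥ :=
    LinearMap.ker_ne_bot_of_finrank_lt (by simp [hd])
  obtain ⟨v, hv, hv0⟩ := Submodule.exists_mem_ne_zero_of_ne_bot hker
  have hv' : η v = 0 := hv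
  have hvp := hpos v hv0
  obtain ⟨E₁, g11, η1⟩ : ∃ E₁, g E₁ E₁ = 1 ∧ η E₁ = 0 := by
    refine ⟨(√(g v v))⁻¹ • v, ?_, by simp [hv']⟩
    have := Real.mul_self_sqrt hvp.le
    have h0 : √(g v v) ≠ 0 := (Real.sqrt_pos.2 hvp).ne'
    simp only [map_smul, smul_apply, smul_eq_mul]
    field_simp
    nlinarith
  have hφφ : φ (φ E₁) = - E₁ := by
    have := hφ E₁
    rw [η1, zero_smul] at this
    exact eq_neg_of_add_eq_zero_left this
  have g12 : g E₁ (φ E₁) = 0 := by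
    have := hskew E₁ E₁
    rw [hΦ] at this
    linarith
  have g22 : g (φ E₁) (φ E₁) = 1 := by
    have := hc E₁ E₁
    rw [g11, η1] at this
    linarith
  have hgζ' : ∀ v, g ζ v = η v := fun v => by rw [hs, hgζ]
  -- With `E₂ = φ E₁` one has `Φ(E₁, E₂) = g(E₁, φ² E₁) = -1`, which fixes the sign in
  -- `IsAdaptedFrame`.
  refine ⟨E₁, φ E₁, ?_, g11, g12, by rw [hs, g12], g22, hgζ, hgζ', η1, hηφ E₁, hη, ?_, ?_, ?_,
    hskew⟩
  · intro v
    have := eq_sum_of_orthonormal hd g (E := ![E₁, φ E₁, ζ]) (fun i j => by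
      fin_cases i <;> fin_cases j <;>
        simp [g11, g12, g22, hgζ, hgζ', η1, hη, hηφ, hs (φ E₁) E₁]) v
    simpa [Fin.sum_univ_three, hgζ] using this
  · rw [hΦ, hφφ, map_neg, g11]
  · rw [hΦ, hφζ, map_zero]
  · rw [hΦ, hφζ, map_zero]

end ExistsFrame

/-! ### Translation between coordinate components and the frame-free operators. -/

section Coordinates

set_option maxSynthPendingDepth 3

variable {d : ℕ}
  {W : Type*} [NormedAddCommGroup W] [NormedSpace ℝ W]

local notation "ℰ" => EuclideanSpace ℝ (Fin d)

/-- The `i`-th coordinate vector of `ℝᵈ`. -/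
abbrev stdVec (i : Fin d) : ℰ := EuclideanSpace.single i (1 : ℝ)

lemma euclidean_eq_sum (v : ℰ) : v = ∑ i, v i • (stdVec i : ℰ) := by
  ext j
  simp [Finset.sum_apply, Pi.single_apply]

/-- Unbundled linearity allows use in a single slot of expressions such as `curvatureOp` or
`covDerivOne`; applied slot by slot, it reduces tensor identities to components. -/
lemma eq_of_eq_on_stdVec {f h : ℰ → W} (hf : IsLinearMap ℝ f) (hh : IsLinearMap ℝ h)
    (H : ∀ i, f (stdVec i) = h (stdVec i)) (v : ℰ) : f v = h v := by
  change IsLinearMap.mk' f hf v = IsLinearMap.mk' h hh v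
  rw [euclidean_eq_sum v, map_sum, map_sum]
  refine Finset.sum_congr rfl fun i _ => ?_
  rw [map_smul, map_smul]
  exact congrArg _ (H i)

/-- The linear map on `ℝᵈ` with prescribed values at the coordinate vectors. -/
def linOfCoords (c : Fin d → W) : ℰ →L[ℝ] W :=
  ∑ i, (EuclideanSpace.proj i : ℰ →L[ℝ] ℝ).smulRight (c i)

/-- The bilinear map on `ℝᵈ` with prescribed values at pairs of coordinate vectors. -/
def bilinOfCoords (c : Fin d → Fin d → W) : ℰ →L[ℝ] ℰ →L[ℝ] W :=
  linOfCoords fun i => linOfCoords (c i)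

lemma linOfCoords_apply (c : Fin d → W) (u : ℰ) : linOfCoords c u = ∑ i, u i • c i := by
  simp [linOfCoords, sum_apply]

@[simp] lemma linOfCoords_stdVec (c : Fin d → W) (i : Fin d) :
    linOfCoords c (stdVec i) = c i := by
  simp [linOfCoords_apply]

@[simp] lemma bilinOfCoords_stdVec (c : Fin d → Fin d → W) (i j : Fin d) :
    bilinOfCoords c (stdVec i) (stdVec j) = c i j := by
  simp [bilinOfCoords]

lemma ContDiffAt.linOfCoords {n : WithTop ℕ∞} {c : ℰ → Fin d → W} {x : ℰ}
    (h : ∀ i, ContDiffAt ℝ n (fun y => c y i) x) :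
    ContDiffAt ℝ n (fun y => linOfCoords (c y)) x := by
  simp only [_root_.linOfCoords]
  refine ContDiffAt.sum fun i _ => ?_
  exact (ContinuousLinearMap.smulRightL ℝ ℰ W (EuclideanSpace.proj i)).contDiff.contDiffAt.comp x
    (h i)

lemma ContDiffAt.bilinOfCoords {n : WithTop ℕ∞} {c : ℰ → Fin d → Fin d → W} {x : ℰ}
    (h : ∀ i j, ContDiffAt ℝ n (fun y => c y i j) x) :
    ContDiffAt ℝ n (fun y => bilinOfCoords (c y)) x :=
  ContDiffAt.linOfCoords fun i => ContDiffAt.linOfCoords fun j => h i j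

/-- The bilinear form on `ℝᵈ` with a given matrix. -/
def bilinOfMatrix (B : Matrix (Fin d) (Fin d) ℝ) : ℰ →L[ℝ] ℰ →L[ℝ] ℝ :=
  bilinOfCoords fun i j => B i j

@[simp] lemma bilinOfMatrix_stdVec (B : Matrix (Fin d) (Fin d) ℝ) (i j : Fin d) :
    bilinOfMatrix B (stdVec i) (stdVec j) = B i j :=
  bilinOfCoords_stdVec _ i j

lemma ContDiffAt.bilinOfMatrix {n : WithTop ℕ∞} {B : ℰ → Matrix (Fin d) (Fin d) ℝ} {x : ℰ}
    (h : ∀ i j, ContDiffAt ℝ n (fun y => B y i j) x) :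
    ContDiffAt ℝ n (fun y => bilinOfMatrix (B y)) x :=
  ContDiffAt.bilinOfCoords h

/-- The Christoffel symbols of `G` as a bilinear map. -/
def christoffelMap (G : ℰ → Matrix (Fin d) (Fin d) ℝ) (y : ℰ) : ℰ →L[ℝ] ℰ →L[ℝ] ℰ :=
  bilinOfCoords fun i j => WithLp.toLp 2 fun k => christoffelCoord G k i j y

variable {G B : EuclideanSpace ℝ (Fin d) → Matrix (Fin d) (Fin d) ℝ}
  {x : EuclideanSpace ℝ (Fin d)}

lemma fderiv_bilinOfMatrix (hB : ∀ i j, DifferentiableAt ℝ (fun y => B y i j) x)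
    (hB' : DifferentiableAt ℝ (fun y => bilinOfMatrix (B y)) x) (t : ℰ) (i j : Fin d) :
    fderiv ℝ (fun y => bilinOfMatrix (B y)) x t (stdVec i) (stdVec j)
      = fderiv ℝ (fun y => B y i j) x t := by
  rw [← fderiv_clm_apply_const_two hB']
  simp

lemma ContDiffAt.pderivCoord {f : ℰ → ℝ} (hf : ContDiffAt ℝ ∞ f x) (i : Fin d) :
    ContDiffAt ℝ ∞ (pderivCoord i f) x :=
  (hf.fderiv_right (m := ∞) (by simp)).clm_apply contDiffAt_const

lemma ContDiffAt.matrix_inv_apply (hG : ∀ i j, ContDiffAt ℝ ∞ (fun y => G y i j) x)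
    (hdet : (G x).det ≠ 0) (i j : Fin d) : ContDiffAt ℝ ∞ (fun y => (G y)⁻¹ i j) x := by
  -- Stated for a general `H` because, besides `det G`, each adjugate entry is a determinant of `G`
  -- with one row replaced.
  have hdetS : ∀ H : ℰ → Matrix (Fin d) (Fin d) ℝ, (∀ i j, ContDiffAt ℝ ∞ (fun y => H y i j) x) →
      ContDiffAt ℝ ∞ (fun y => (H y).det) x := by
    intro H hH
    simp only [Matrix.det_apply]
    refine ContDiffAt.sum fun σ _ => ?_
    simp only [Units.smul_def, zsmul_eq_mul]
    exact contDiffAt_const.mul (contDiffAt_prod fun k _ => hH _ _)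
  have hadj : ContDiffAt ℝ ∞ (fun y => (G y).adjugate i j) x := by
    simp only [Matrix.adjugate_apply]
    refine hdetS _ fun k l => ?_
    by_cases hk : k = j
    · subst hk
      simpa using contDiffAt_const
    · simpa [Matrix.updateRow_ne hk] using hG k l
  have : (fun y => (G y)⁻¹ i j) = fun y => ((G y).det)⁻¹ * (G y).adjugate i j := by
    ext y
    simp [Matrix.inv_def, Ring.inverse_eq_inv']
  rw [this]
  exact ((hdetS G hG).inv hdet).mul hadj

lemma ContDiffAt.christoffelCoord (hG : ∀ i j, ContDiffAt ℝ ∞ (fun y => G y i j) x)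
    (hdet : (G x).det ≠ 0) (k i j : Fin d) : ContDiffAt ℝ ∞ (christoffelCoord G k i j) x := by
  refine contDiffAt_const.mul (ContDiffAt.sum fun l _ => ?_)
  exact (ContDiffAt.matrix_inv_apply hG hdet k l).mul
    ((((hG j l).pderivCoord i).add ((hG i l).pderivCoord j)).sub ((hG i j).pderivCoord l))

lemma ContDiffAt.christoffelMap (hG : ∀ i j, ContDiffAt ℝ ∞ (fun y => G y i j) x)
    (hdet : (G x).det ≠ 0) : ContDiffAt ℝ ∞ (christoffelMap G) x := by
  refine ContDiffAt.bilinOfCoords fun i j => ?_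
  rw [contDiffAt_euclidean]
  exact fun k => ContDiffAt.christoffelCoord hG hdet k i j

lemma christoffelMap_stdVec (i j k : Fin d) :
    christoffelMap G x (stdVec i) (stdVec j) k = christoffelCoord G k i j x := by
  simp [christoffelMap]

lemma christoffelCoord_symm (hs : ∀ᶠ y in nhds x, (G y).IsSymm) (k i j : Fin d) :
    christoffelCoord G k i j x = christoffelCoord G k j i x := by
  have : ∀ l, _root_.pderivCoord l (fun y => G y i j) x
      = _root_.pderivCoord l (fun y => G y j i) x := by
    intro l
    have : (fun y => G y i j) =ᶠ[nhds x] fun y => G y j i := hs.mono fun y hy => hy.apply j i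
    simp only [_root_.pderivCoord, this.fderiv_eq (𝕜 := ℝ)]
  simp only [_root_.christoffelCoord, this]
  congr 1
  refine Finset.sum_congr rfl fun l _ => ?_
  ring

lemma christoffelMap_symm (hs : ∀ᶠ y in nhds x, (G y).IsSymm) (u v : ℰ) :
    christoffelMap G x u v = christoffelMap G x v u := by
  refine eq_of_eq_on_stdVec (f := fun u => christoffelMap G x u v)
    (h := fun u => christoffelMap G x v u) (by constructor <;> simp) (by constructor <;> simp)
    (fun i => ?_) u
  refine eq_of_eq_on_stdVec (f := fun v => christoffelMap G x (stdVec i) v)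
    (h := fun v => christoffelMap G x v (stdVec i)) (by constructor <;> simp)
    (by constructor <;> simp) (fun j => ?_) v
  ext k
  simp only [christoffelMap_stdVec, christoffelCoord_symm hs k i j]

lemma bilinOfMatrix_christoffelMap (B : Matrix (Fin d) (Fin d) ℝ) (i j k : Fin d) :
    bilinOfMatrix B (christoffelMap G x (stdVec i) (stdVec j)) (stdVec k)
      = ∑ l, christoffelCoord G l i j x * B l k := by
  conv_lhs => rw [euclidean_eq_sum (christoffelMap G x (stdVec i) (stdVec j))]
  simp only [map_sum, map_smul, sum_apply, smul_apply, bilinOfMatrix_stdVec,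
    christoffelMap_stdVec, smul_eq_mul]

lemma bilinOfMatrix_christoffelMap' (B : Matrix (Fin d) (Fin d) ℝ) (i j k : Fin d) :
    bilinOfMatrix B (stdVec k) (christoffelMap G x (stdVec i) (stdVec j))
      = ∑ l, christoffelCoord G l i j x * B k l := by
  conv_lhs => rw [euclidean_eq_sum (christoffelMap G x (stdVec i) (stdVec j))]
  simp only [map_sum, map_smul, bilinOfMatrix_stdVec,
    christoffelMap_stdVec, smul_eq_mul]

/-- Lowering the upper index cancels the inverse metric and leaves the Christoffel symbols of the
first kind; two of these add up to a derivative of the metric in `christoffelMap_compat`. -/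
lemma sum_christoffelCoord_mul (hs : ∀ᶠ y in nhds x, (G y).IsSymm) (hdet : (G x).det ≠ 0)
    (i j m : Fin d) : ∑ l, christoffelCoord G l i j x * G x l m
      = (1 / 2) * (_root_.pderivCoord i (fun y => G y j m) x
        + _root_.pderivCoord j (fun y => G y i m) x - _root_.pderivCoord m (fun y => G y i j) x) := by
  have hinv : G x * (G x)⁻¹ = 1 := Matrix.mul_nonsing_inv _ (isUnit_iff_ne_zero.2 hdet)
  simp only [_root_.christoffelCoord, mul_assoc, Finset.sum_mul, Finset.mul_sum]
  rw [Finset.sum_comm]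
  have h1 : ∀ p, ∑ l, G x m l * (G x)⁻¹ l p = if m = p then 1 else 0 := by
    intro p
    rw [← Matrix.mul_apply, hinv, Matrix.one_apply]
  have : ∀ p, (∑ l, (1 / 2 : ℝ) * ((G x)⁻¹ l p * ((_root_.pderivCoord i (fun y => G y j p) x
        + _root_.pderivCoord j (fun y => G y i p) x - _root_.pderivCoord p (fun y => G y i j) x)
          * G x l m)))
      = (if m = p then 1 else 0) * ((1 / 2 : ℝ) * (_root_.pderivCoord i (fun y => G y j p) x
        + _root_.pderivCoord j (fun y => G y i p) x - _root_.pderivCoord p (fun y => G y i j) x)) := by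
    intro p
    rw [← h1 p, Finset.sum_mul]
    refine Finset.sum_congr rfl fun l _ => ?_
    rw [hs.self_of_nhds.apply m l]
    ring
  simp only [this]
  simp

/-- The Levi-Civita connection is metric. -/
lemma christoffelMap_compat (hG : ∀ i j, ContDiffAt ℝ ∞ (fun y => G y i j) x)
    (hs : ∀ᶠ y in nhds x, (G y).IsSymm) (hdet : (G x).det ≠ 0) (u v w : ℰ) :
    fderiv ℝ (fun y => bilinOfMatrix (G y)) x u v w
      = bilinOfMatrix (G x) (christoffelMap G x u v) w
        + bilinOfMatrix (G x) v (christoffelMap G x u w) := by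
  revert u v w
  have base : ∀ k i j, fderiv ℝ (fun y => bilinOfMatrix (G y)) x (stdVec k) (stdVec i) (stdVec j)
      = bilinOfMatrix (G x) (christoffelMap G x (stdVec k) (stdVec i)) (stdVec j)
        + bilinOfMatrix (G x) (stdVec i) (christoffelMap G x (stdVec k) (stdVec j)) := by
    intro k i j
    have hd : DifferentiableAt ℝ (fun y => bilinOfMatrix (G y)) x :=
      (ContDiffAt.bilinOfMatrix hG).differentiableAt (by simp)
    rw [fderiv_bilinOfMatrix (fun i j => (hG i j).differentiableAt (by simp)) hd,
      bilinOfMatrix_christoffelMap, bilinOfMatrix_christoffelMap', sum_christoffelCoord_mul hs hdet]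
    have hsx := hs.self_of_nhds
    have h2 : ∀ l, G x i l = G x l i := fun l => hsx.apply l i
    simp only [h2]
    rw [sum_christoffelCoord_mul hs hdet]
    have hp : ∀ l a b, _root_.pderivCoord l (fun y => G y a b) x
        = _root_.pderivCoord l (fun y => G y b a) x := by
      intro l a b
      have : (fun y => G y a b) =ᶠ[nhds x] fun y => G y b a := hs.mono fun y hy => hy.apply b a
      simp only [_root_.pderivCoord, this.fderiv_eq (𝕜 := ℝ)]
    rw [hp k j i, hp j k i, hp i k j]
    change _root_.pderivCoord k (fun y => G y i j) x = _
    rw [hp j i k]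
    ring
  intro u v w
  refine eq_of_eq_on_stdVec (f := fun u => fderiv ℝ (fun y => bilinOfMatrix (G y)) x u v w)
    (h := fun u => bilinOfMatrix (G x) (christoffelMap G x u v) w
        + bilinOfMatrix (G x) v (christoffelMap G x u w))
    (by constructor <;> intros <;> simp) (by constructor <;> intros <;> simp <;> ring)
    (fun k => ?_) u
  refine eq_of_eq_on_stdVec
    (f := fun v => fderiv ℝ (fun y => bilinOfMatrix (G y)) x (stdVec k) v w)
    (h := fun v => bilinOfMatrix (G x) (christoffelMap G x (stdVec k) v) w
        + bilinOfMatrix (G x) v (christoffelMap G x (stdVec k) w))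
    (by constructor <;> intros <;> simp) (by constructor <;> intros <;> simp <;> ring)
    (fun i => ?_) v
  exact eq_of_eq_on_stdVec
    (f := fun w => fderiv ℝ (fun y => bilinOfMatrix (G y)) x (stdVec k) (stdVec i) w)
    (h := fun w => bilinOfMatrix (G x) (christoffelMap G x (stdVec k) (stdVec i)) w
        + bilinOfMatrix (G x) (stdVec i) (christoffelMap G x (stdVec k) w))
    (by constructor <;> intros <;> simp) (by constructor <;> intros <;> simp <;> ring)
    (fun j => base k i j) w

lemma covDerivTwo_stdVec (hB : ∀ i j, ContDiffAt ℝ ∞ (fun y => B y i j) x) (k i j : Fin d) :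
    covDerivTwo (christoffelMap G) (fun y => bilinOfMatrix (B y)) x (stdVec k) (stdVec i) (stdVec j)
      = covDerivCoord G B k i j x := by
  simp only [covDerivTwo]
  rw [fderiv_bilinOfMatrix (fun i j => (hB i j).differentiableAt (by simp))
    ((ContDiffAt.bilinOfMatrix hB).differentiableAt (by simp)), bilinOfMatrix_christoffelMap,
    bilinOfMatrix_christoffelMap']
  rfl

lemma curvatureOp_stdVec (hΓ : DifferentiableAt ℝ (christoffelMap G) x) (l i j k : Fin d) :
    curvatureOp (christoffelMap G) x (stdVec i) (stdVec j) (stdVec k) l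
      = curvatureCoord G l i j k x := by
  have h1 : ∀ (t : ℰ) (j k : Fin d), fderiv ℝ (christoffelMap G) x t (stdVec j) (stdVec k) l
      = fderiv ℝ (christoffelCoord G l j k) x t := by
    intro t j k
    have hΓc : DifferentiableAt ℝ (fun y => christoffelMap G y (stdVec j) (stdVec k)) x :=
      (hΓ.clm_apply (differentiableAt_const _)).clm_apply (differentiableAt_const _)
    rw [← fderiv_clm_apply_const_two hΓ]
    have := ((EuclideanSpace.proj l : ℰ →L[ℝ] ℝ).hasFDerivAt.comp x hΓc.hasFDerivAt).fderiv
    have h2 : (⇑(EuclideanSpace.proj l : ℰ →L[ℝ] ℝ) ∘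
        fun y => christoffelMap G y (stdVec j) (stdVec k)) = christoffelCoord G l j k := by
      ext y
      exact christoffelMap_stdVec j k l
    rw [h2] at this
    rw [this]
    simp
  have h2 : ∀ i j k : Fin d, christoffelMap G x (stdVec i)
      (christoffelMap G x (stdVec j) (stdVec k)) l
      = ∑ p, christoffelCoord G l i p x * christoffelCoord G p j k x := by
    intro i j k
    conv_lhs => rw [euclidean_eq_sum (christoffelMap G x (stdVec j) (stdVec k))]
    simp only [map_sum, map_smul, WithLp.ofLp_sum, Finset.sum_apply, PiLp.smul_apply, smul_eq_mul,
      christoffelMap_stdVec, mul_comm]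
  simp only [curvatureOp, PiLp.sub_apply, PiLp.add_apply, h1, h2, curvatureCoord,
    Finset.sum_sub_distrib]
  rfl

/-- The Ricci tensor computed in an orthonormal frame. -/
lemma ricci_frame {G : EuclideanSpace ℝ (Fin 3) → Matrix (Fin 3) (Fin 3) ℝ}
    {g Φ : EuclideanSpace ℝ (Fin 3) →L[ℝ] EuclideanSpace ℝ (Fin 3) →L[ℝ] ℝ}
    {η : EuclideanSpace ℝ (Fin 3) →L[ℝ] ℝ} {x E₁ E₂ E₃ : EuclideanSpace ℝ (Fin 3)}
    (hE : IsAdaptedFrame g Φ η E₁ E₂ E₃) (hΓ : DifferentiableAt ℝ (christoffelMap G) x)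
    (T : EuclideanSpace ℝ (Fin 3) →L[ℝ] EuclideanSpace ℝ (Fin 3) →L[ℝ] ℝ)
    (hT : ∀ j k, ricciCoord G j k x = T (stdVec j) (stdVec k)) (v w : EuclideanSpace ℝ (Fin 3)) :
    g (curvatureOp (christoffelMap G) x E₁ v w) E₁ + g (curvatureOp (christoffelMap G) x E₂ v w) E₂
      + g (curvatureOp (christoffelMap G) x E₃ v w) E₃ = T v w := by
  have hlin : ∀ v w, IsLinearMap ℝ fun u => curvatureOp (christoffelMap G) x u v w := by
    intro v w
    constructor <;> intros <;>
      simp only [curvatureOp, map_add, map_smul, add_apply, smul_apply, smul_sub, smul_add] <;> abel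
  -- Basis independence of the trace, with `L` to be `u ↦ K(u, v) w`.
  have htr : ∀ L : EuclideanSpace ℝ (Fin 3) → EuclideanSpace ℝ (Fin 3), IsLinearMap ℝ L →
      g (L E₁) E₁ + g (L E₂) E₂ + g (L E₃) E₃ = ∑ i, L (stdVec i) i := by
    intro L hL
    have hg : ∀ a b, g a b = ∑ i, a i * g (stdVec i) b := by
      intro a b
      conv_lhs => rw [euclidean_eq_sum a]
      simp only [map_sum, map_smul, sum_apply, smul_apply, smul_eq_mul]
    have hLi : ∀ i, L (stdVec i) i = g (stdVec i) E₁ * L E₁ i + g (stdVec i) E₂ * L E₂ i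
        + g (stdVec i) E₃ * L E₃ i := by
      intro i
      conv_lhs => rw [hE.expand (stdVec i), hL.map_add, hL.map_add, hL.map_smul, hL.map_smul,
        hL.map_smul, ← hE.g₃]
      simp
    simp only [hLi, Finset.sum_add_distrib]
    rw [hg (L E₁), hg (L E₂), hg (L E₃)]
    simp only [mul_comm]
  rw [htr _ (hlin v w)]
  refine eq_of_eq_on_stdVec
    (f := fun v => ∑ i, curvatureOp (christoffelMap G) x (stdVec i) v w i)
    (h := fun v => T v w) ?_ (by constructor <;> intros <;> simp) (fun j => ?_) v
  · constructor <;> intros <;>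
      simp only [curvatureOp, map_add, map_smul, add_apply, smul_apply, PiLp.add_apply,
        PiLp.sub_apply, PiLp.smul_apply, smul_eq_mul, Finset.mul_sum,
        ← Finset.sum_add_distrib] <;>
      refine Finset.sum_congr rfl fun i _ => ?_ <;> ring
  refine eq_of_eq_on_stdVec
    (f := fun w => ∑ i, curvatureOp (christoffelMap G) x (stdVec i) (stdVec j) w i)
    (h := fun w => T (stdVec j) w) ?_ (by constructor <;> intros <;> simp) (fun k => ?_) w
  · constructor <;> intros <;>
      simp only [curvatureOp, map_add, map_smul, PiLp.add_apply,
        PiLp.sub_apply, PiLp.smul_apply, smul_eq_mul, Finset.mul_sum,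
        ← Finset.sum_add_distrib] <;>
      refine Finset.sum_congr rfl fun i _ => ?_ <;> ring
  simp only [curvatureOp_stdVec hΓ]
  exact hT j k

end Coordinates
-- Smoothness and algebra of the structure read in a chart.
section ChartPullback

open Bundle

set_option maxSynthPendingDepth 3

variable {d : ℕ} {M : Type*} [TopologicalSpace M] [ChartedSpace (EuclideanSpace ℝ (Fin d)) M]
  [IsManifold (𝓡 d) ∞ M] {e : OpenPartialHomeomorph M (EuclideanSpace ℝ (Fin d))}
  {y : EuclideanSpace ℝ (Fin d)}

/-- The derivative of the inverse of a chart is a linear isomorphism. -/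
lemma exists_equiv_mfderiv_symm (he : e ∈ IsManifold.maximalAtlas (𝓡 d) ∞ M) (hy : y ∈ e.target) :
    ∃ T : EuclideanSpace ℝ (Fin d) ≃L[ℝ] TangentSpace (𝓡 d) (e.symm y),
      ∀ i, T (stdVec i) = coordVector e i y := by
  have h : e.MDifferentiable (𝓡 d) (𝓡 d) :=
    ⟨(contMDiffOn_of_mem_maximalAtlas he).mdifferentiableOn (by simp),
      (contMDiffOn_symm_of_mem_maximalAtlas he).mdifferentiableOn (by simp)⟩
  exact ⟨h.symm.mfderiv hy, fun i => rfl⟩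

/-- A coordinate field is the tangent map of `e.symm` applied to a constant section, hence smooth.
-/
lemma contMDiffOn_coordVector (he : e ∈ IsManifold.maximalAtlas (𝓡 d) ∞ M) (i : Fin d) :
    ContMDiffOn (𝓡 d) ((𝓡 d).prod 𝓘(ℝ, EuclideanSpace ℝ (Fin d))) ∞
      (fun y => TotalSpace.mk' (EuclideanSpace ℝ (Fin d))
        (E := fun p : M => TangentSpace (𝓡 d) p) (e.symm y) (coordVector e i y)) e.target := by
  have : IsManifold (𝓡 d) 1 M := IsManifold.of_le (n := ∞) (by simp)
  have h1 := (contMDiffOn_symm_of_mem_maximalAtlas he).contMDiffOn_tangentMapWithin (m := ∞)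
    (by simp) e.open_target.uniqueMDiffOn
  have h2 : ContMDiffOn (𝓡 d) (𝓡 d).tangent ∞
      (fun y => (⟨y, (stdVec i : EuclideanSpace ℝ (Fin d))⟩ :
        TangentBundle (𝓡 d) (EuclideanSpace ℝ (Fin d)))) e.target :=
    contMDiffOn_vectorSpace_iff_contDiffOn.2 contDiffOn_const
  refine (h1.comp h2 fun y hy => hy).congr fun y hy => ?_
  simp only [Function.comp, tangentMapWithin, mfderivWithin_of_isOpen e.open_target hy]
  rfl

namespace AlmostContactMetricStructure

variable (S : AlmostContactMetricStructure d M)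

lemma contDiffAt_gCoord (he : e ∈ IsManifold.maximalAtlas (𝓡 d) ∞ M) (hy : y ∈ e.target)
    (i j : Fin d) : ContDiffAt ℝ ∞ (fun z => S.gCoord e z i j) y := by
  have hb : ContMDiffWithinAt (𝓡 d) (𝓡 d) ∞ e.symm e.target y :=
    contMDiffOn_symm_of_mem_maximalAtlas he y hy
  have : ContMDiffWithinAt (𝓡 d) ((𝓡 d).prod 𝓘(ℝ, ℝ)) ∞ (fun z => TotalSpace.mk' ℝ
      (E := Bundle.Trivial M ℝ) (e.symm z)
      (S.g.inner (e.symm z) (coordVector e i z) (coordVector e j z))) e.target y := by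
    apply ContMDiffWithinAt.clm_bundle_apply₂ (F₁ := EuclideanSpace ℝ (Fin d))
      (F₂ := EuclideanSpace ℝ (Fin d))
    · exact ContMDiffAt.comp_contMDiffWithinAt y S.g.contMDiff.contMDiffAt hb
    · exact contMDiffOn_coordVector he i y hy
    · exact contMDiffOn_coordVector he j y hy
  simp only [contMDiffWithinAt_totalSpace] at this
  exact (contMDiffWithinAt_iff_contDiffWithinAt.1 this.2).contDiffAt (e.open_target.mem_nhds hy)

lemma contDiffAt_ηCoord (he : e ∈ IsManifold.maximalAtlas (𝓡 d) ∞ M) (hy : y ∈ e.target)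
    (i : Fin d) : ContDiffAt ℝ ∞ (S.ηCoord e i) y := by
  have hb : ContMDiffWithinAt (𝓡 d) (𝓡 d) ∞ e.symm e.target y :=
    contMDiffOn_symm_of_mem_maximalAtlas he y hy
  have : ContMDiffWithinAt (𝓡 d) ((𝓡 d).prod 𝓘(ℝ, ℝ)) ∞ (fun z => TotalSpace.mk' ℝ
      (E := Bundle.Trivial M ℝ) (e.symm z) (S.η (e.symm z) (coordVector e i z))) e.target y := by
    apply ContMDiffWithinAt.clm_bundle_apply (F₁ := EuclideanSpace ℝ (Fin d))
    · exact ContMDiffAt.comp_contMDiffWithinAt y S.contMDiff_η.contMDiffAt hb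
    · exact contMDiffOn_coordVector he i y hy
  simp only [contMDiffWithinAt_totalSpace] at this
  exact (contMDiffWithinAt_iff_contDiffWithinAt.1 this.2).contDiffAt (e.open_target.mem_nhds hy)

lemma contDiffAt_ΦCoord (he : e ∈ IsManifold.maximalAtlas (𝓡 d) ∞ M) (hy : y ∈ e.target)
    (i j : Fin d) : ContDiffAt ℝ ∞ (fun z => S.ΦCoord e z i j) y := by
  have hb : ContMDiffWithinAt (𝓡 d) (𝓡 d) ∞ e.symm e.target y :=
    contMDiffOn_symm_of_mem_maximalAtlas he y hy
  have : ContMDiffWithinAt (𝓡 d) ((𝓡 d).prod 𝓘(ℝ, ℝ)) ∞ (fun z => TotalSpace.mk' ℝ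
      (E := Bundle.Trivial M ℝ) (e.symm z) (S.g.inner (e.symm z) (coordVector e i z)
        (S.φ (e.symm z) (coordVector e j z)))) e.target y := by
    apply ContMDiffWithinAt.clm_bundle_apply₂ (F₁ := EuclideanSpace ℝ (Fin d))
      (F₂ := EuclideanSpace ℝ (Fin d))
    · exact ContMDiffAt.comp_contMDiffWithinAt y S.g.contMDiff.contMDiffAt hb
    · exact contMDiffOn_coordVector he i y hy
    · apply ContMDiffWithinAt.clm_bundle_apply (F₁ := EuclideanSpace ℝ (Fin d))
      · exact ContMDiffAt.comp_contMDiffWithinAt y S.contMDiff_φ.contMDiffAt hb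
      · exact contMDiffOn_coordVector he j y hy
  simp only [contMDiffWithinAt_totalSpace] at this
  exact (contMDiffWithinAt_iff_contDiffWithinAt.1 this.2).contDiffAt (e.open_target.mem_nhds hy)

/-- The structure read in a chart, at one point, as an almost contact metric structure of `ℝᵈ`. -/
lemma exists_pullback (he : e ∈ IsManifold.maximalAtlas (𝓡 d) ∞ M) (hy : y ∈ e.target) :
    (∀ u v, bilinOfMatrix (S.gCoord e y) u v = bilinOfMatrix (S.gCoord e y) v u) ∧
    (∀ v, v ≠ 0 → 0 < bilinOfMatrix (S.gCoord e y) v v) ∧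
    ∃ (φ : EuclideanSpace ℝ (Fin d) →L[ℝ] EuclideanSpace ℝ (Fin d)) (ζ : EuclideanSpace ℝ (Fin d)),
      (∀ v, φ (φ v) + v = linOfCoords (fun i => S.ηCoord e i y) v • ζ) ∧
      linOfCoords (fun i => S.ηCoord e i y) ζ = 1 ∧
      (∀ v w, bilinOfMatrix (S.gCoord e y) v w = bilinOfMatrix (S.gCoord e y) (φ v) (φ w)
        + linOfCoords (fun i => S.ηCoord e i y) v * linOfCoords (fun i => S.ηCoord e i y) w) ∧
      ∀ v w, bilinOfMatrix (S.ΦCoord e y) v w = bilinOfMatrix (S.gCoord e y) v (φ w) := by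
  obtain ⟨T, hT⟩ := exists_equiv_mfderiv_symm he hy
  have hη : ∀ v, linOfCoords (fun i => S.ηCoord e i y) v = S.η (e.symm y) (T v) := by
    intro v
    refine eq_of_eq_on_stdVec (f := fun v => linOfCoords (fun i => S.ηCoord e i y) v)
      (h := fun v => S.η (e.symm y) (T v)) (by constructor <;> simp)
      (by constructor <;> simp) (fun i => ?_) v
    simp [hT, ηCoord]
  have hbil : ∀ (B : EuclideanSpace ℝ (Fin d) → EuclideanSpace ℝ (Fin d) → ℝ)
      (A : Matrix (Fin d) (Fin d) ℝ), (∀ v, IsLinearMap ℝ fun u => B u v) →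
      (∀ u, IsLinearMap ℝ (B u)) → (∀ i j, A i j = B (stdVec i) (stdVec j)) →
      ∀ u v, bilinOfMatrix A u v = B u v := by
    intro B A h1 h2 hA u v
    refine eq_of_eq_on_stdVec (f := fun u => bilinOfMatrix A u v)
      (h := fun u => B u v) (by constructor <;> simp) (h1 v) (fun i => ?_) u
    refine eq_of_eq_on_stdVec (f := fun v => bilinOfMatrix A (stdVec i) v)
      (h := fun v => B (stdVec i) v) (by constructor <;> simp) (h2 _) (fun j => ?_) v
    rw [bilinOfMatrix_stdVec, hA]
  have hg : ∀ u v, bilinOfMatrix (S.gCoord e y) u v = S.g.inner (e.symm y) (T u) (T v) := by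
    refine hbil (fun u v => S.g.inner (e.symm y) (T u) (T v)) _ (fun v => ?_) (fun u => ?_)
      fun i j => ?_
    · constructor <;> simp
    · constructor <;> simp
    · rw [hT, hT]; rfl
  have hΦ : ∀ u v, bilinOfMatrix (S.ΦCoord e y) u v
      = S.g.inner (e.symm y) (T u) (S.φ (e.symm y) (T v)) := by
    refine hbil (fun u v => S.g.inner (e.symm y) (T u) (S.φ (e.symm y) (T v))) _ (fun v => ?_)
      (fun u => ?_) fun i j => ?_
    · constructor <;> simp
    · constructor <;> simp
    · rw [hT, hT]; rfl
  -- `φ` and `ζ` are transported by the isomorphism `T = d(e.symm)`: conjugation for `φ`, preimage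
  -- for `ζ`.
  refine ⟨fun u v => ?_, fun v hv => ?_, (T.symm : _ →L[ℝ] _).comp
    ((S.φ (e.symm y)).comp (T : _ →L[ℝ] _)), T.symm (S.ζ (e.symm y)), ?_, ?_, ?_, ?_⟩
  · rw [hg, hg, S.g.symm]
  · rw [hg]
    exact S.g.pos _ _ fun h => hv (by simpa using h)
  · intro v
    apply T.injective
    simpa [hη] using S.φ_sq (e.symm y) (T v)
  · rw [hη]; simpa using S.η_ζ (e.symm y)
  · intro v w
    simp only [hg, hη]
    simpa using S.compatible (e.symm y) (T v) (T w)
  · intro v w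
    rw [hΦ, hg]
    simp

/-- A kernel vector of the Gram matrix would have zero length, against positivity. -/
lemma det_gCoord_ne_zero (he : e ∈ IsManifold.maximalAtlas (𝓡 d) ∞ M) (hy : y ∈ e.target) :
    (S.gCoord e y).det ≠ 0 := by
  intro h
  obtain ⟨v, hv, hv0⟩ := Matrix.exists_mulVec_eq_zero_iff.2 h
  obtain ⟨hs, hpos, -⟩ := S.exists_pullback he hy
  have h1 := hpos (WithLp.toLp 2 v) (by simpa using hv)
  have h2 : bilinOfMatrix (S.gCoord e y) (WithLp.toLp 2 v) (WithLp.toLp 2 v)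
      = ∑ i, v i * (S.gCoord e y).mulVec v i := by
    simp [bilinOfMatrix, bilinOfCoords, linOfCoords_apply, sum_apply, Matrix.mulVec, dotProduct,
      mul_comm]
  rw [h2, hv0] at h1
  simp at h1

lemma isSymm_gCoord (e : OpenPartialHomeomorph M (EuclideanSpace ℝ (Fin d)))
    (y : EuclideanSpace ℝ (Fin d)) : (S.gCoord e y).IsSymm := by
  ext i j
  exact S.g.symm _ _ _

end AlmostContactMetricStructure

end ChartPullback

/-! ### Hessian, scalar curvature and closedness in a chart. -/

section ChartIdentities

open Filter Topology

set_option maxSynthPendingDepth 3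

lemma covDerivOne_fderiv_stdVec {d : ℕ} {G : EuclideanSpace ℝ (Fin d) → Matrix (Fin d) (Fin d) ℝ}
    {f : EuclideanSpace ℝ (Fin d) → ℝ} {y : EuclideanSpace ℝ (Fin d)} (hf : ContDiffAt ℝ ∞ f y)
    (i j : Fin d) :
    covDerivOne (christoffelMap G) (fderiv ℝ f) y (stdVec i) (stdVec j)
      = hessianCoord G f i j y := by
  have hd : DifferentiableAt ℝ (fderiv ℝ f) y :=
    (hf.fderiv_right (m := ∞) (by simp)).differentiableAt (by simp)
  simp only [covDerivOne]
  rw [← fderiv_clm_apply_const hd, euclidean_eq_sum (christoffelMap G y (stdVec i) (stdVec j))]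
  simp only [map_sum, map_smul, smul_eq_mul, christoffelMap_stdVec]
  rfl

lemma fderiv_linOfCoords_stdVec {d : ℕ} {c : Fin d → EuclideanSpace ℝ (Fin d) → ℝ}
    {y : EuclideanSpace ℝ (Fin d)} (hc : ∀ i, ContDiffAt ℝ ∞ (c i) y) (i j : Fin d) :
    fderiv ℝ (fun z => linOfCoords fun k => c k z) y (stdVec i) (stdVec j)
      = pderivCoord i (c j) y := by
  have hd : DifferentiableAt ℝ (fun z => linOfCoords fun k => c k z) y :=
    (ContDiffAt.linOfCoords (c := fun z k => c k z) hc).differentiableAt (by simp)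
  rw [← fderiv_clm_apply_const hd]
  simp only [linOfCoords_stdVec]
  rfl

variable {d : ℕ} {M : Type*} [TopologicalSpace M] [ChartedSpace (EuclideanSpace ℝ (Fin d)) M]
  [IsManifold (𝓡 d) ∞ M] {e : OpenPartialHomeomorph M (EuclideanSpace ℝ (Fin d))}
  {x : EuclideanSpace ℝ (Fin d)}

namespace AlmostContactMetricStructure

variable (S : AlmostContactMetricStructure d M)

/-- The scalar curvature of an `η`-Einstein structure. -/
lemma IsEtaEinstein.scalarCoord_eq {S : AlmostContactMetricStructure d M} {a b : ℝ}
    (h : S.IsEtaEinstein a b) (he : e ∈ IsManifold.maximalAtlas (𝓡 d) ∞ M) (hx : x ∈ e.target) :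
    scalarCoord (S.gCoord e) x = d * a + b := by
  have hdet := S.det_gCoord_ne_zero he hx
  have hs := S.isSymm_gCoord e x
  obtain ⟨-, -, φ, ζ, hφ, hηζ, hc, -⟩ := S.exists_pullback he hx
  have hinv : (S.gCoord e x)⁻¹ * S.gCoord e x = 1 :=
    Matrix.nonsing_inv_mul _ (isUnit_iff_ne_zero.2 hdet)
  -- `η` is metrically dual to `ζ`: this is compatibility at `(∂ₖ, ζ)` once `φ ζ = 0`.
  have hη : ∀ k, S.ηCoord e k x = ∑ l, S.gCoord e x k l * ζ l := by
    have hφζ : φ ζ = 0 := by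
      obtain ⟨-, hpos, -⟩ := S.exists_pullback he hx
      by_contra h0
      have h1 := hc ζ ζ
      have h2 : φ (φ ζ) = 0 := by simpa [hηζ] using hφ ζ
      have h3 := hpos _ h0
      have h4 := hc (φ ζ) (φ ζ)
      have h5 := hφ (φ ζ)
      rw [h2, map_zero, zero_add] at h5
      rw [h2, map_zero] at h4
      have h6 : φ (φ ζ) = linOfCoords (fun i => S.ηCoord e i x) (φ ζ) • φ ζ := by
        conv_lhs => rw [h5, map_smul]
      rw [h2] at h6
      rcases smul_eq_zero.1 h6.symm with h7 | h7
      · rw [h7] at h5; exact h0 (by simpa using h5)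
      · exact h0 h7
    intro k
    have h1 := hc (stdVec k) ζ
    rw [hφζ, map_zero, hηζ, zero_add, mul_one, linOfCoords_stdVec] at h1
    rw [← h1]
    conv_lhs => rw [euclidean_eq_sum ζ]
    simp only [map_sum, map_smul, smul_eq_mul, bilinOfMatrix_stdVec, mul_comm]
  have hηζ' : ∑ j, ζ j * S.ηCoord e j x = 1 := by
    rw [← hηζ, linOfCoords_apply]; rfl
  have hζ : ∀ j, ∑ k, (S.gCoord e x)⁻¹ j k * S.ηCoord e k x = ζ j := by
    intro j
    have h1 : (fun k => S.ηCoord e k x) = (S.gCoord e x).mulVec fun l => ζ l := by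
      ext k; rw [hη]; rfl
    change ((S.gCoord e x)⁻¹.mulVec fun k => S.ηCoord e k x) j = _
    rw [h1, Matrix.mulVec_mulVec, hinv, Matrix.one_mulVec]
  -- A diagonal entry of `G⁻¹ G`, not summed over `j`; the later sum over `j` produces the factor
  -- `d`.
  have htr : ∀ j, ∑ k, (S.gCoord e x)⁻¹ j k * S.gCoord e x j k = 1 := by
    intro j
    have h1 := congrFun (congrFun hinv j) j
    rw [Matrix.mul_apply, Matrix.one_apply_eq] at h1
    rw [← h1]
    exact Finset.sum_congr rfl fun k _ => by rw [hs.apply k j]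
  have hj : ∀ j, ∑ k, (S.gCoord e x)⁻¹ j k * ricciCoord (S.gCoord e) j k x
      = a + b * (ζ j * S.ηCoord e j x) := by
    intro j
    rw [← hζ j, ← mul_one a, ← htr j, Finset.mul_sum, Finset.sum_mul, Finset.mul_sum,
      ← Finset.sum_add_distrib]
    refine Finset.sum_congr rfl fun k _ => ?_
    rw [h e he x hx]
    ring
  simp only [scalarCoord, hj, Finset.sum_add_distrib, ← Finset.mul_sum, hηζ']
  simp

lemma IsAlmostCoKahler.fderiv_η_symm {S : AlmostContactMetricStructure d M}
    (h : S.IsAlmostCoKahler) (he : e ∈ IsManifold.maximalAtlas (𝓡 d) ∞ M) (hx : x ∈ e.target)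
    (u v : EuclideanSpace ℝ (Fin d)) :
    fderiv ℝ (fun z => linOfCoords fun i => S.ηCoord e i z) x u v
      = fderiv ℝ (fun z => linOfCoords fun i => S.ηCoord e i z) x v u := by
  set L := fderiv ℝ (fun z => linOfCoords fun i => S.ηCoord e i z) x with hL
  refine eq_of_eq_on_stdVec (f := fun u => L u v) (h := fun u => L v u)
    (by constructor <;> simp) (by constructor <;> simp) (fun i => ?_) u
  refine eq_of_eq_on_stdVec (f := fun v => L (stdVec i) v) (h := fun v => L v (stdVec i))
    (by constructor <;> simp) (by constructor <;> simp) (fun j => ?_) v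
  simp only [hL, fderiv_linOfCoords_stdVec fun i => S.contDiffAt_ηCoord he hx i]
  exact (h e he x hx).1 i j

lemma IsAlmostCoKahler.fderiv_Φ_cyclic {S : AlmostContactMetricStructure d M}
    (h : S.IsAlmostCoKahler) (he : e ∈ IsManifold.maximalAtlas (𝓡 d) ∞ M) (hx : x ∈ e.target)
    (t u v : EuclideanSpace ℝ (Fin d)) :
    fderiv ℝ (fun z => bilinOfMatrix (S.ΦCoord e z)) x t u v
      + fderiv ℝ (fun z => bilinOfMatrix (S.ΦCoord e z)) x u v t
      + fderiv ℝ (fun z => bilinOfMatrix (S.ΦCoord e z)) x v t u = 0 := by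
  have hB : ∀ i j, ContDiffAt ℝ ∞ (fun y => S.ΦCoord e y i j) x := S.contDiffAt_ΦCoord he hx
  have hd : DifferentiableAt ℝ (fun z => bilinOfMatrix (S.ΦCoord e z)) x :=
    (ContDiffAt.bilinOfMatrix hB).differentiableAt (by simp)
  set L := fderiv ℝ (fun z => bilinOfMatrix (S.ΦCoord e z)) x with hL
  refine eq_of_eq_on_stdVec (f := fun t => L t u v + L u v t + L v t u) (h := fun _ => (0 : ℝ))
    (by constructor <;> intros <;> simp <;> ring) (by constructor <;> simp) (fun i => ?_) t
  refine eq_of_eq_on_stdVec (f := fun u => L (stdVec i) u v + L u v (stdVec i) + L v (stdVec i) u)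
    (h := fun _ => (0 : ℝ))
    (by constructor <;> intros <;> simp <;> ring) (by constructor <;> simp) (fun j => ?_) u
  refine eq_of_eq_on_stdVec (f := fun v => L (stdVec i) (stdVec j) v + L (stdVec j) v (stdVec i)
    + L v (stdVec i) (stdVec j)) (h := fun _ => (0 : ℝ))
    (by constructor <;> intros <;> simp <;> ring) (by constructor <;> simp) (fun k => ?_) v
  simp only [hL, fderiv_bilinOfMatrix (fun i j => (hB i j).differentiableAt (by simp)) hd]
  exact (h e he x hx).2 i j k

end AlmostContactMetricStructure

end ChartIdentities

/-! ### Vanishing of `∇η` and of `∇Φ` in dimension three. -/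

section CoKahler

open Filter Topology

set_option maxSynthPendingDepth 3

variable {M : Type*} [TopologicalSpace M] [ChartedSpace (EuclideanSpace ℝ (Fin 3)) M]
  [IsManifold (𝓡 3) ∞ M] {e : OpenPartialHomeomorph M (EuclideanSpace ℝ (Fin 3))}
  {x : EuclideanSpace ℝ (Fin 3)}

namespace AlmostContactMetricStructure

/-- The frame is chosen at each point separately. No smooth choice is needed, since only the
frame-free area identity gets differentiated. -/
lemma exists_isAdaptedFrame_chart (S : AlmostContactMetricStructure 3 M)
    (he : e ∈ IsManifold.maximalAtlas (𝓡 3) ∞ M) (hx : x ∈ e.target) :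
    ∃ E₁ E₂ E₃, IsAdaptedFrame (bilinOfMatrix (S.gCoord e x)) (bilinOfMatrix (S.ΦCoord e x))
      (linOfCoords fun i => S.ηCoord e i x) E₁ E₂ E₃ := by
  obtain ⟨hs, hpos, φ, ζ, hφ, hη, hc, hΦ⟩ := S.exists_pullback he hx
  obtain ⟨E₁, E₂, h⟩ := exists_isAdaptedFrame (by simp) hs hpos hφ hη hc hΦ
  exact ⟨E₁, E₂, ζ, h⟩

/-- In dimension three, an almost co-Kähler `η`-Einstein structure with `b ≠ 0` carrying a function
`f` with `Hess f = s df ⊗ df + ν g - b η ⊗ η` has parallel fundamental form. -/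
theorem covDerivCoord_Φ_eq_zero {S : AlmostContactMetricStructure 3 M} (hS : S.IsAlmostCoKahler)
    {a b s ν : ℝ} (hb : b ≠ 0) (hEin : S.IsEtaEinstein a b)
    (he : e ∈ IsManifold.maximalAtlas (𝓡 3) ∞ M) {f : EuclideanSpace ℝ (Fin 3) → ℝ}
    (hf : ∀ y ∈ e.target, ContDiffAt ℝ ∞ f y)
    (hess : ∀ y ∈ e.target, ∀ i j, hessianCoord (S.gCoord e) f i j y
      = s * (pderivCoord i f y * pderivCoord j f y) + ν * S.gCoord e y i j
        - b * (S.ηCoord e i y * S.ηCoord e j y))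
    (hx : x ∈ e.target) (k i j : Fin 3) :
    covDerivCoord (S.gCoord e) (S.ΦCoord e) k i j x = 0 := by
  have h2 : (2 : WithTop ℕ∞) ≤ ((⊤ : ℕ∞) : WithTop ℕ∞) :=
    WithTop.coe_le_coe.2 (le_top : (2 : ℕ∞) ≤ ⊤)
  have hnhds : ∀ᶠ y in 𝓝 x, y ∈ e.target := e.open_target.mem_nhds hx
  have hGc := S.contDiffAt_gCoord he hx
  have hdet := S.det_gCoord_ne_zero he hx
  set Γ := christoffelMap (S.gCoord e) with hΓdef
  set g : EuclideanSpace ℝ (Fin 3) → _ := fun y => bilinOfMatrix (S.gCoord e y) with hgdef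
  set Φ : EuclideanSpace ℝ (Fin 3) → _ := fun y => bilinOfMatrix (S.ΦCoord e y) with hΦdef
  set η : EuclideanSpace ℝ (Fin 3) → _ := fun y => linOfCoords fun i => S.ηCoord e i y with hηdef
  have hg : ContDiffAt ℝ ∞ g x := ContDiffAt.bilinOfMatrix hGc
  have hΦ : ContDiffAt ℝ ∞ Φ x := ContDiffAt.bilinOfMatrix (S.contDiffAt_ΦCoord he hx)
  have hη : ContDiffAt ℝ ∞ η x :=
    ContDiffAt.linOfCoords (c := fun z k => S.ηCoord e k z) (S.contDiffAt_ηCoord he hx)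
  have hΓ : ContDiffAt ℝ ∞ Γ x := ContDiffAt.christoffelMap hGc hdet
  have hg1 := hg.differentiableAt (by simp)
  have hΦ1 := hΦ.differentiableAt (by simp)
  have hη1 := hη.differentiableAt (by simp)
  have hΓ1 := hΓ.differentiableAt (by simp)
  have hsymm : ∀ y, ∀ᶠ z in 𝓝 y, (S.gCoord e z).IsSymm :=
    fun y => Eventually.of_forall fun z => S.isSymm_gCoord e z
  have hΓs : ∀ u v, Γ x u v = Γ x v u := christoffelMap_symm (hsymm x)
  have hcompat : ∀ᶠ y in 𝓝 x, ∀ u v w,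
      fderiv ℝ g y u v w = g y (Γ y u v) w + g y v (Γ y u w) := hnhds.mono fun y hy =>
    christoffelMap_compat (S.contDiffAt_gCoord he hy) (hsymm y) (S.det_gCoord_ne_zero he hy)
  have hgs : ∀ u v, g x u v = g x v u := (S.exists_pullback he hx).1
  obtain ⟨E₁, E₂, E₃, hE⟩ := S.exists_isAdaptedFrame_chart he hx
  have hE : IsAdaptedFrame (g x) (Φ x) (η x) E₁ E₂ E₃ := hE
  have hηc : ∀ u v, fderiv ℝ η x u v = fderiv ℝ η x v u := hS.fderiv_η_symm he hx
  have hΦsw : ∀ᶠ y in 𝓝 x, ∀ u v, Φ y u v = - Φ y v u := hnhds.mono fun y hy => by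
    obtain ⟨_, _, _, h⟩ := S.exists_isAdaptedFrame_chart he hy
    exact h.Φ_swap
  have hΦsx := hΦsw.self_of_nhds
  have hNs : ∀ t u v, covDerivTwo Γ Φ x t u v = - covDerivTwo Γ Φ x t v u := by
    intro t u v
    have h1 : (fun y => Φ y u v) =ᶠ[𝓝 x] fun y => - Φ y v u := hΦsw.mono fun y hy => hy u v
    have h2 := DFunLike.congr_fun (h1.fderiv_eq (𝕜 := ℝ)) t
    rw [fderiv_fun_neg, neg_apply, fderiv_clm_apply_const_two hΦ1,
      fderiv_clm_apply_const_two hΦ1] at h2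
    simp only [covDerivTwo]
    linear_combination h2 - hΦsx (Γ x t u) v - hΦsx u (Γ x t v)
  -- In the cyclic sum the connection terms cancel, `Γ` being symmetric and `Φ` skew.
  have hdΦ : ∀ t u v, covDerivTwo Γ Φ x t u v + covDerivTwo Γ Φ x u v t
      + covDerivTwo Γ Φ x v t u = 0 := by
    intro t u v
    have h1 : fderiv ℝ Φ x t u v + fderiv ℝ Φ x u v t + fderiv ℝ Φ x v t u = 0 :=
      hS.fderiv_Φ_cyclic he hx t u v
    simp only [covDerivTwo]
    rw [hΓs u t, hΓs v u, hΓs v t]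
    linear_combination h1 - hΦsx (Γ x t u) v - hΦsx (Γ x u v) t - hΦsx u (Γ x t v)
  have harea : ∀ᶠ y in 𝓝 x, ∀ u v w z, Φ y u v * Φ y w z
      = (g y u w - η y u * η y w) * (g y v z - η y v * η y z)
        - (g y u z - η y u * η y z) * (g y v w - η y v * η y w) := hnhds.mono fun y hy => by
    obtain ⟨_, _, _, h⟩ := S.exists_isAdaptedFrame_chart he hy
    exact h.area
  obtain ⟨htr, hN, hA3⟩ := covDerivOne_trace hE hNs hdΦ
    (covDerivTwo_area hg1 hΦ1 hη1 hcompat.self_of_nhds harea)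
  have hess' : ∀ᶠ y in 𝓝 x, ∀ u v, covDerivOne Γ (fderiv ℝ f) y u v
      = s * (fderiv ℝ f y u * fderiv ℝ f y v) + ν * g y u v - b * (η y u * η y v) := by
    refine hnhds.mono fun y hy u v => ?_
    refine eq_of_eq_on_stdVec (f := fun u => covDerivOne Γ (fderiv ℝ f) y u v)
      (h := fun u => s * (fderiv ℝ f y u * fderiv ℝ f y v) + ν * g y u v - b * (η y u * η y v))
      (by constructor <;> intros <;> simp [covDerivOne] <;> ring)
      (by constructor <;> intros <;> simp <;> ring) (fun i => ?_) u
    refine eq_of_eq_on_stdVec (f := fun v => covDerivOne Γ (fderiv ℝ f) y (stdVec i) v)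
      (h := fun v => s * (fderiv ℝ f y (stdVec i) * fderiv ℝ f y v) + ν * g y (stdVec i) v
        - b * (η y (stdVec i) * η y v))
      (by constructor <;> intros <;> simp [covDerivOne] <;> ring)
      (by constructor <;> intros <;> simp <;> ring) (fun j => ?_) v
    simp only [hΓdef, covDerivOne_fderiv_stdVec (hf y hy), hess y hy, hgdef, hηdef,
      bilinOfMatrix_stdVec, linOfCoords_stdVec]
    rfl
  have hfx := hf x hx
  have hθ : ContDiffAt ℝ ∞ (fderiv ℝ f) x := hfx.fderiv_right (by simp)
  have hθs : ∀ t u v, fderiv ℝ (fderiv ℝ (fderiv ℝ f)) x t u v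
      = fderiv ℝ (fderiv ℝ (fderiv ℝ f)) x u t v := fun t u v => by
    rw [(hθ.isSymmSndFDerivAt (by simpa using h2)) t u]
  have hskew := curvatureOp_skew (hg.of_le h2) hΓ1 hcompat
  have hRic := ricci_frame hE hΓ1
    (a • g x + b • (η x).smulRight (η x)) (fun j k => by
      rw [hEin e he x hx]
      simp [hgdef, hηdef])
  have hRic' : ∀ v w, g x (curvatureOp Γ x E₁ v w) E₁ + g x (curvatureOp Γ x E₂ v w) E₂
      + g x (curvatureOp Γ x E₃ v w) E₃ = a * g x v w + b * (η x v * η x w) := by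
    intro v w
    rw [hRic]
    simp
  obtain ⟨h11, h12, h21⟩ := covDerivOne_umbilic (a := a) (Φ := Φ) hb hE hskew hgs hRic'
    (ricci_identity_of_covDeriv_eq hg1 hΓ1 hη1 (hθ.of_le (by simp)) hΓs hgs
      hcompat.self_of_nhds hηc hθs
      ((hθ.fderiv_right (m := ∞) (by simp)).differentiableAt (by simp)) hess')
  have hAs : ∀ u v, covDerivOne Γ η x u v = covDerivOne Γ η x v u := by
    intro u v
    simp only [covDerivOne, hηc u v, hΓs u v]
  have hexp : ∀ t c, covDerivOne Γ η x t c = g x t E₁ * covDerivOne Γ η x E₁ c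
      + g x t E₂ * covDerivOne Γ η x E₂ c + η x t * covDerivOne Γ η x E₃ c := by
    intro t c
    conv_lhs => rw [hE.expand t]
    simp only [covDerivOne, map_add, map_smul, add_apply, smul_apply, smul_eq_mul]
    ring
  -- The diagonal entries of `∇η` on `ker η` are equal with sum zero; the entries involving `E₃`
  -- vanish by `hA3` and symmetry.
  have hA1 : ∀ t, covDerivOne Γ η x t E₁ = 0 := by
    intro t
    rw [hexp, hAs E₃ E₁, hA3, h21, show covDerivOne Γ η x E₁ E₁ = 0 by linarith]
    simp
  have hA2 : ∀ t, covDerivOne Γ η x t E₂ = 0 := by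
    intro t
    rw [hexp, hAs E₃ E₂, hA3, h12, show covDerivOne Γ η x E₂ E₂ = 0 by linarith]
    simp
  rw [← covDerivTwo_stdVec (S.contDiffAt_ΦCoord he hx)]
  exact hN hA1 hA2 _ _ _

end AlmostContactMetricStructure

end CoKahler

end

theorem mainTheorem5 {M : Type*} [TopologicalSpace M] [T2Space M] [SecondCountableTopology M]
    [ChartedSpace (EuclideanSpace ℝ (Fin 3)) M] [IsManifold (𝓡 3) ∞ M]
    (S : AlmostContactMetricStructure 3 M) (hS : S.IsAlmostCoKahler)
    (a₁ b₁ : ℝ) (hb₁ : b₁ ≠ 0) (hEin : S.IsEtaEinstein a₁ b₁)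
    (m : ℝ≥0∞) (hm_pos : 0 < m) (hm_ne : m ≠ 1) (ρ : ℝ) (hsol : S.IsQuasiEinstein m ρ)
    (hab : m ≠ ⊤ → m.toReal * a₁ ≠ b₁) :
    S.IsCoKahler := by
  refine ⟨hS, fun e he x hx k i j => ?_⟩
  obtain ⟨w, lam, hw, hsol⟩ := hsol
  have hf : ∀ y ∈ e.target, ContDiffAt ℝ ∞ (w ∘ e.symm) y := fun y hy =>
    (contMDiffOn_iff_contDiffOn.1
      (hw.comp_contMDiffOn (contMDiffOn_symm_of_mem_maximalAtlas he))).contDiffAt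
      (e.open_target.mem_nhds hy)
  -- `ν` is `ρ τ + λ₁` with `τ = 3a₁ + b₁`, less the `a₁ g` moved over from `Ric`. For `m = ⊤` the
  -- coefficient `s` is `0`.
  refine AlmostContactMetricStructure.covDerivCoord_Φ_eq_zero (s := (m⁻¹).toReal)
    (ν := ρ * ((3 : ℕ) * a₁ + b₁) + lam - a₁) hS hb₁ hEin he hf (fun y hy i j => ?_) hx k i j
  have h1 := hsol e he y hy i j
  rw [hEin e he y hy, hEin.scalarCoord_eq he hy] at h1
  linear_combination h1
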